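/- A toric metric is a smooth $S^1$-invariant Hermitian metric $h$ on $\mathcal O(1)\to\mathbb{CP}^1$ with positive curvature form. In the affine chart $z$ write $|e_0|_h^2=e^{-u(z)}$ for the standard frame $e_0$, so that $|z^{N\alpha}|_{h^N}^2=|z|^{2N\alpha}e^{-Nu(z)}$ and the curvature form is $\omega_h=\sqrt{-1}\,\partial\bar\partial u$. Put $U(\rho)=u(z)$ for $\rho=\log|z|^2$. The symplectic potential of $h$ is the Legendre transform $G(x)=\sup_{\rho\in\mathbb R}(x\rho-U(\rho))$, $x\in P=[0,1]$. Let $h_P$ be the metric with $u_P(z)=\log(1+|z|^2)$, whose symplectic potential is $G_P(x)=x\log x+(1-x)\log(1-x)$. Let $(h_t)_{t\in[0,1]}$ be a smooth geodesic of toric metrics, that is, its potentials are smooth jointly in $t\in[0,1]$ and the point of $\mathbb{CP}^1$, and satisfy $\ddot\varphi_t=|\partial\dot\varphi_t|^2_{\omega_{h_t}}$, where $h_t=e^{-\varphi_t}h_0$. Let $G_t$ be the symplectic potential of $h_t$. For every integer $N>0$ and every real $\alpha\in[0,1]$ put $$\mathcal Q_t^N(\alpha)=\int_{\mathbb{CP}^1}|z^{N\alpha}|^2_{h_t^N}\,\omega_{h_t},\quad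 Q_t^N(\alpha)=\mathcal Q_t^N(\alpha)e^{-NG_t(\alpha)},\quad q_t^N(\alpha)=\frac{Q_t^N(\alpha)}{Q_P^N(\alpha)},$$ where $Q_P^N(\alpha)$ is defined in the same way from $h_P$ and $G_P$. **Theorem 3.1.** There is a constant $C>0$ such that for all integers $N>0$, all $\alpha\in[0,1]$ and all $t\in[0,1]$, $$\frac1C\le q_t^N(\alpha)\le C.$$ Furthermore, for every $t\in[0,1]$ the function $\Omega_t(\alpha)=\left(\dfrac{G_P''(\alpha)}{G_t''(\alpha)}\right)^{1/2}$, $0<\alpha<1$, extends to a continuous function on $[0,1]$, and $\lim_{N\to\infty}q_t^N(\alpha)=\Omega_t(\alpha)$ uniformly for $\alpha\in[0,1]$. -/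

import Mathlib

open Set Filter MeasureTheory
open scoped ContDiff Laplacian

namespace ToricCP1

/-- The complex Hessian `∂²u / ∂z ∂z̄` of a real function on `ℂ`, i.e. one quarter of the
Laplacian. -/
noncomputable def ddbar (u : ℂ → ℝ) (z : ℂ) : ℝ := (1 / 4) * Δ u z

/-- The Wirtinger derivative `∂f / ∂z = (∂f/∂x - i ∂f/∂y) / 2` of a real function on `ℂ`. -/
noncomputable def dz (f : ℂ → ℝ) (z : ℂ) : ℂ :=
  (1 / 2) * ((fderiv ℝ f z 1 : ℂ) - Complex.I * (fderiv ℝ f z Complex.I : ℂ))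

/-- A smooth `S¹`-invariant Hermitian metric of positive curvature on `𝒪(1) → ℂP¹`.
Over the affine chart `z ∈ ℂ` the frame `e₀` of `𝒪(1)` has `|e₀|² = exp (-pot z)`; over the chart
`w = 1 / z` around the point at infinity the frame `e₁ = z e₀` has `|e₁|² = exp (-potInf w)`.
The curvature form `√-1 ∂∂̄ pot` (which is `√-1 ∂∂̄ potInf` in the other chart) is positive on all
of `ℂP¹`. -/
structure ToricMetric where
  pot : ℂ → ℝ
  potInf : ℂ → ℝ
  smooth_pot : ContDiff ℝ ∞ pot
  smooth_potInf : ContDiff ℝ ∞ potInf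
  compat : ∀ w : ℂ, w ≠ 0 → potInf w = pot w⁻¹ + Real.log (‖w‖ ^ 2)
  rot : ∀ c z : ℂ, ‖c‖ = 1 → pot (c * z) = pot z
  pos_pot : ∀ z, 0 < ddbar pot z
  pos_potInf : ∀ w, 0 < ddbar potInf w

/-- The potential on the open orbit in the logarithmic coordinate `ρ = log |z|²`. -/
noncomputable def ToricMetric.U (h : ToricMetric) (ρ : ℝ) : ℝ := h.pot (Real.exp (ρ / 2) : ℂ)

/-- The symplectic potential of the curvature form of `h`: the Legendre transform
`G x = sup_ρ (x ρ - U ρ)`. For `0 < x < 1` the supremum is attained where `U' ρ = x`; at `x = 0, 1`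
it is the continuous extension. -/
noncomputable def ToricMetric.G (h : ToricMetric) (x : ℝ) : ℝ := ⨆ ρ : ℝ, (x * ρ - h.U ρ)

/-- `∫_{ℂP¹} |z^{Nα}|²_{h^N} ω_h`, where `ω_h = √-1 (∂²u/∂z∂z̄) dz ∧ dz̄` and
`√-1 dz ∧ dz̄` is twice the Lebesgue measure of `ℂ`. Here `α` may be any real number. -/
noncomputable def ToricMetric.normSq (h : ToricMetric) (N : ℕ) (α : ℝ) : ℝ :=
  ∫ z : ℂ, ‖z‖ ^ (2 * (N * α)) * Real.exp (-(N * h.pot z)) * (2 * ddbar h.pot z)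

/-- The reference symplectic potential of the polytope `[0, 1]`. -/
noncomputable def GP (x : ℝ) : ℝ := x * Real.log x + (1 - x) * Real.log (1 - x)

/-- The path `t ↦ h t`, `0 ≤ t ≤ 1`, is a smooth geodesic in the space of toric metrics of positive
curvature: it is jointly smooth up to the end points of time, and
`φ'' = |∂φ'|²_{ω_φ} = (∂²u/∂z∂z̄)⁻¹ |∂φ'/∂z|²`, where `u = pot` is the potential `φ` relative to a
fixed metric up to a summand independent of time. (At `z = ∞` the equation then holds by
continuity.) -/
structure IsGeodesic (h : ℝ → ToricMetric) : Prop where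
  smooth : ContDiffOn ℝ ∞ (fun p : ℝ × ℂ => (h p.1).pot p.2) (Icc 0 1 ×ˢ univ)
  smoothInf : ContDiffOn ℝ ∞ (fun p : ℝ × ℂ => (h p.1).potInf p.2) (Icc 0 1 ×ˢ univ)
  eqn : ∀ t ∈ Ioo (0 : ℝ) 1, ∀ z : ℂ,
    deriv (deriv fun s => (h s).pot z) t =
      ‖dz (fun y => deriv (fun s => (h s).pot y) t) z‖ ^ 2 / ddbar (h t).pot z

theorem smooth_log : ContDiff ℝ ∞ (fun z : ℂ => Real.log (1 + ‖z‖ ^ 2)) := by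
  refine ContDiff.log (contDiff_const.add (contDiff_norm_sq ℝ)) fun z => ?_
  positivity

theorem second_deriv (a b t : ℝ) :
    deriv (deriv fun t : ℝ => Real.log (1 + ((a + t) ^ 2 + b ^ 2))) t =
      (2 * (1 + (a + t) ^ 2 + b ^ 2) - 4 * (a + t) ^ 2) / (1 + (a + t) ^ 2 + b ^ 2) ^ 2 := by
  have hp : ∀ t : ℝ, (1 + ((a + t) ^ 2 + b ^ 2)) ≠ 0 := fun t => by positivity
  have h1 : ∀ t : ℝ, HasDerivAt (fun t : ℝ => 1 + ((a + t) ^ 2 + b ^ 2)) (2 * (a + t)) t := by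
    intro t
    have := ((((hasDerivAt_id t).const_add a).pow 2).add_const (b ^ 2)).const_add 1
    simpa using this
  have h2 : (deriv fun t : ℝ => Real.log (1 + ((a + t) ^ 2 + b ^ 2))) =
      fun t => 2 * (a + t) / (1 + ((a + t) ^ 2 + b ^ 2)) := by
    funext t
    exact ((h1 t).log (hp t)).deriv
  have h3 : HasDerivAt (fun t : ℝ => 2 * (a + t)) 2 t := by
    simpa using ((hasDerivAt_id t).const_add a).const_mul 2
  rw [h2, (h3.fun_div (h1 t) (hp t)).deriv, ← add_assoc]
  ring

theorem iteratedFDeriv_two_line {f : ℂ → ℝ} (hf : ContDiff ℝ ∞ f) (z v : ℂ) :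
    iteratedFDeriv ℝ 2 f z ![v, v] = deriv (deriv fun t : ℝ => f (z + t • v)) 0 := by
  have hd : ∀ t : ℝ, HasDerivAt (fun t : ℝ => z + t • v) v t := fun t => by
    simpa using ((hasDerivAt_id t).smul_const v).const_add z
  have h1 : (deriv fun t : ℝ => f (z + t • v)) = fun t => fderiv ℝ f (z + t • v) v := by
    funext t
    exact (((hf.differentiable (by simp)) _).hasFDerivAt.comp_hasDerivAt t (hd t)).deriv
  have h2 : Differentiable ℝ (fderiv ℝ f) :=
    ((contDiff_infty.mp hf 2).fderiv_right (m := 1) (by norm_num)).differentiable (by simp)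
  have h3 : HasDerivAt (fun t : ℝ => fderiv ℝ f (z + t • v))
      (fderiv ℝ (fderiv ℝ f) (z + (0 : ℝ) • v) v) 0 :=
    (h2 (z + (0 : ℝ) • v)).hasFDerivAt.comp_hasDerivAt (0 : ℝ) (hd 0)
  have h4 : HasDerivAt (fun t : ℝ => fderiv ℝ f (z + t • v) v)
      (fderiv ℝ (fderiv ℝ f) (z + (0 : ℝ) • v) v v) 0 := by
    simpa using h3.clm_apply (hasDerivAt_const (0 : ℝ) v)
  rw [h1, h4.deriv, iteratedFDeriv_two_apply]
  simp

theorem ddbar_log (z : ℂ) :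
    ddbar (fun z : ℂ => Real.log (1 + ‖z‖ ^ 2)) z = 1 / (1 + ‖z‖ ^ 2) ^ 2 := by
  have hn : ∀ z : ℂ, ‖z‖ ^ 2 = z.re ^ 2 + z.im ^ 2 := fun z => by
    rw [Complex.sq_norm, Complex.normSq_apply]; ring
  have e1 : (fun t : ℝ => Real.log (1 + ‖z + t • (1 : ℂ)‖ ^ 2)) =
      fun t : ℝ => Real.log (1 + ((z.re + t) ^ 2 + z.im ^ 2)) := by
    funext t; rw [hn]; simp
  have e2 : (fun t : ℝ => Real.log (1 + ‖z + t • Complex.I‖ ^ 2)) =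
      fun t : ℝ => Real.log (1 + ((z.im + t) ^ 2 + z.re ^ 2)) := by
    funext t; rw [hn]; simp [add_comm]
  have hp : (1 + z.re ^ 2 + z.im ^ 2) ≠ 0 := by positivity
  have hq : (1 + z.im ^ 2 + z.re ^ 2) = (1 + z.re ^ 2 + z.im ^ 2) := by ring
  rw [ddbar, InnerProductSpace.laplacian_eq_iteratedFDeriv_complexPlane]
  beta_reduce
  rw [iteratedFDeriv_two_line smooth_log, iteratedFDeriv_two_line smooth_log, e1, e2,
    second_deriv, second_deriv, hn, add_zero, add_zero, hq, ← add_assoc]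
  field_simp
  ring

/-- The canonical metric: its potential is `log (1 + |z|²)`, the Legendre transform of `GP` (see
`isGreatest_canonical`), i.e. it is the Fubini-Study metric. -/
noncomputable def canonical : ToricMetric where
  pot z := Real.log (1 + ‖z‖ ^ 2)
  potInf z := Real.log (1 + ‖z‖ ^ 2)
  smooth_pot := smooth_log
  smooth_potInf := smooth_log
  compat w hw := by
    have : ‖w‖ ≠ 0 := norm_ne_zero_iff.mpr hw
    rw [← Real.log_mul (by positivity) (by positivity), norm_inv]
    congr 1
    field_simp
    ring
  rot c z hc := by rw [norm_mul, hc, one_mul]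
  pos_pot z := by rw [ddbar_log]; positivity
  pos_potInf z := by rw [ddbar_log]; positivity

theorem mul_log_sub_le {a b : ℝ} (ha : 0 ≤ a) (hb : 0 < b) :
    a * (Real.log b - Real.log a) ≤ b - a := by
  rcases ha.eq_or_lt with rfl | ha
  · simpa using hb.le
  · rw [← Real.log_div hb.ne' ha.ne']
    calc a * Real.log (b / a) ≤ a * (b / a - 1) :=
          mul_le_mul_of_nonneg_left (Real.log_le_sub_one_of_pos (by positivity)) ha.le
      _ = b - a := by field_simp

theorem canonical_U (ρ : ℝ) : canonical.U ρ = Real.log (1 + Real.exp ρ) := by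
  have : Real.exp (ρ / 2) ^ 2 = Real.exp ρ := by
    rw [← Real.exp_nat_mul]; congr 1; push_cast; ring
  simp only [ToricMetric.U, canonical, Complex.norm_real, Real.norm_eq_abs, Real.abs_exp, this]

/-- The potential of the canonical metric on the open orbit is the Legendre transform of `GP`. -/
theorem isGreatest_canonical (ρ : ℝ) :
    IsGreatest ((fun x => x * ρ - GP x) '' Icc 0 1) (canonical.U ρ) := by
  have hS : 0 < 1 + Real.exp ρ := by positivity
  have hE := Real.exp_pos ρ
  have l1 : Real.log (Real.exp ρ / (1 + Real.exp ρ)) = ρ - Real.log (1 + Real.exp ρ) := by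
    rw [Real.log_div hE.ne' hS.ne', Real.log_exp]
  have l2 : Real.log (1 / (1 + Real.exp ρ)) = -Real.log (1 + Real.exp ρ) := by
    rw [one_div, Real.log_inv]
  have hs : Real.exp ρ / (1 + Real.exp ρ) + 1 / (1 + Real.exp ρ) = 1 := by
    field_simp
    ring
  rw [canonical_U]
  constructor
  · refine ⟨Real.exp ρ / (1 + Real.exp ρ), ⟨by positivity, ?_⟩, ?_⟩
    · have : 0 < 1 / (1 + Real.exp ρ) := by positivity
      linarith
    · have e : 1 - Real.exp ρ / (1 + Real.exp ρ) = 1 / (1 + Real.exp ρ) := by linarith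
      simp only [GP, e, l1, l2]
      linear_combination Real.log (1 + Real.exp ρ) * hs
  · rintro _ ⟨x, ⟨h0, h1⟩, rfl⟩
    have i1 := mul_log_sub_le h0 (div_pos hE hS)
    have i2 := mul_log_sub_le (sub_nonneg.mpr h1) (one_div_pos.mpr hS)
    rw [l1] at i1
    rw [l2] at i2
    simp only [GP]
    nlinarith

/-- The normalized norming constant
`Q_h^N(α) = e^{-N G_h(α)} ∫ |z^{Nα}|²_{h^N} ω_h` of a toric metric, divided by that of the canonical
metric, whose symplectic potential is `GP`. -/
noncomputable def q (h : ToricMetric) (N : ℕ) (α : ℝ) : ℝ :=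
  (h.normSq N α * Real.exp (-(N * h.G α))) /
    (canonical.normSq N α * Real.exp (-(N * GP α)))

end ToricCP1

/-! The moment map `x = U' ρ` carries the open orbit to `(0, 1)` and pushes `ω_h` forward to `2π
dx`. Hence `Q_h^N(α) = 2π ∫ exp (-N D_α(x)) dx` over `(0, 1)` (`normSq_mul_exp_of_eqOn`, `q_eq`),
where `D_α(x) = G(α) - G(x) - G'(x)(α - x)` is the Bregman divergence of `G`. Since `D_α' = (x - α)
G''` and `D_α → 0` at `α`, an inequality between Hessians passes to the divergences
(`IsDivergence.le_of_le`).

Put `Γ = G'' / GP''`. It extends continuously and positively to `[0, 1]` with the value `1` at both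
ends (`continuousOn_Gam`), and along the path it is pinched between constants independent of `t`
(`exists_Gam_bounds`). The divergence of `GP` is convex in `x` and vanishes at `α`, so contracting
towards `α` shows that replacing `N` by `s N` with `s ≤ 1` increases its Laplace integral at most by
the factor `1 / s` (`mul_laplaceInt_divP_le`). Pinching of `Γ` therefore bounds `q`
(`laplaceInt_ratio_bounds`).

For the limit, only values of `Γ` near `α` matter, because `D_α` grows at least quadratically. At an
end point `Γ` is close to `1` and the same comparison squeezes the ratio to `1`
(`tendsto_laplaceInt_ratio_of_eq_one`). At an interior point Laplace's method gives `Γ ^ (-1/2)`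
(`tendsto_sqrt_mul_laplaceInt`). Both limits are joint in `N → ∞` and `α → α₀`, so compactness of
`[0, 1]` makes the convergence uniform. -/

namespace ToricCP1

open scoped Topology

/-! ### Divergences with prescribed Hessian and their comparison. -/

/-- `D` is the function on `(0, 1)` with derivative `(x - α) b x` and limit `0` at `α`; for
`b = G''` this is the Bregman divergence of `G` between `α` and `x`. -/
structure IsDivergence (b : ℝ → ℝ) (α : ℝ) (D : ℝ → ℝ) : Prop where
  hasDerivAt : ∀ x ∈ Ioo (0 : ℝ) 1, HasDerivAt D ((x - α) * b x) x
  tendsto : Tendsto D (𝓝[Ioo 0 1] α) (𝓝 0)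

namespace IsDivergence

variable {b b₁ b₂ : ℝ → ℝ} {α : ℝ} {D D₁ D₂ : ℝ → ℝ}

theorem continuousOn (h : IsDivergence b α D) : ContinuousOn D (Ioo 0 1) := fun x hx =>
  (h.hasDerivAt x hx).continuousAt.continuousWithinAt

theorem const_mul (h : IsDivergence b α D) (c : ℝ) :
    IsDivergence (fun x => c * b x) α (fun x => c * D x) where
  hasDerivAt x hx := ((h.hasDerivAt x hx).const_mul c).congr_deriv (by ring)
  tendsto := by simpa using h.tendsto.const_mul c

theorem sub (h₁ : IsDivergence b₁ α D₁) (h₂ : IsDivergence b₂ α D₂) :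
    IsDivergence (fun x => b₁ x - b₂ x) α (fun x => D₁ x - D₂ x) where
  hasDerivAt x hx := ((h₁.hasDerivAt x hx).sub (h₂.hasDerivAt x hx)).congr_deriv (by ring)
  tendsto := by simpa using h₁.tendsto.sub h₂.tendsto

theorem quadratic (κ α : ℝ) : IsDivergence (fun _ => κ) α (fun x => κ / 2 * (x - α) ^ 2) where
  hasDerivAt x _ := by
    refine ((((hasDerivAt_id x).sub_const α).pow 2).const_mul (κ / 2)).congr_deriv ?_
    simp
    ring
  tendsto := by
    have : ContinuousAt (fun x : ℝ => κ / 2 * (x - α) ^ 2) α := by fun_prop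
    simpa [ContinuousAt] using this.tendsto.mono_left nhdsWithin_le_nhds

/-- The derivative `(x - α) b x` has the sign of `x - α`, so `D` falls to its limit `0` at `α` and
rises afterwards. Using a limit within `(0, 1)` instead of a value admits `α = 0, 1`, and the
interval `J` makes the argument local. -/
theorem nonneg_of_nonneg (h : IsDivergence b α D) (hα : α ∈ Icc (0 : ℝ) 1) {J : Set ℝ}
    (hJ : J.OrdConnected) (hαJ : α ∈ J) (hb : ∀ x ∈ Ioo (0 : ℝ) 1, x ∈ J → 0 ≤ b x) {x : ℝ}
    (hx : x ∈ Ioo (0 : ℝ) 1) (hxJ : x ∈ J) : 0 ≤ D x := by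
  rcases lt_trichotomy α x with hlt | rfl | hlt
  · have hsub : Ioc α x ⊆ Ioo 0 1 := fun y hy => ⟨hα.1.trans_lt hy.1, hy.2.trans_lt hx.2⟩
    have hsJ : Ioc α x ⊆ J := fun y hy => hJ.out hαJ hxJ ⟨hy.1.le, hy.2⟩
    have hm : MonotoneOn D (Ioc α x) := by
      refine monotoneOn_of_deriv_nonneg (convex_Ioc α x) (h.continuousOn.mono hsub) ?_ ?_
      · exact fun y hy =>
          (h.hasDerivAt y (hsub (interior_subset hy))).differentiableAt.differentiableWithinAt
      · intro y hy
        have hy := interior_subset hy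
        rw [(h.hasDerivAt y (hsub hy)).deriv]
        exact mul_nonneg (sub_nonneg.2 hy.1.le) (hb y (hsub hy) (hsJ hy))
    have hne : (𝓝[Ioc α x] α).NeBot := by
      rw [nhdsWithin_Ioc_eq_nhdsGT hlt]; infer_instance
    refine le_of_tendsto (h.tendsto.mono_left (nhdsWithin_mono α hsub)) ?_
    filter_upwards [self_mem_nhdsWithin] with y hy using hm hy ⟨hlt, le_rfl⟩ hy.2
  · have h1 : Tendsto D (𝓝 α) (𝓝 0) := by
      simpa [isOpen_Ioo.nhdsWithin_eq hx] using h.tendsto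
    exact (tendsto_nhds_unique (h.hasDerivAt α hx).continuousAt.tendsto h1).ge
  · have hsub : Ico x α ⊆ Ioo 0 1 := fun y hy => ⟨hx.1.trans_le hy.1, hy.2.trans_le hα.2⟩
    have hsJ : Ico x α ⊆ J := fun y hy => hJ.out hxJ hαJ ⟨hy.1, hy.2.le⟩
    have hm : AntitoneOn D (Ico x α) := by
      refine antitoneOn_of_deriv_nonpos (convex_Ico x α) (h.continuousOn.mono hsub) ?_ ?_
      · exact fun y hy =>
          (h.hasDerivAt y (hsub (interior_subset hy))).differentiableAt.differentiableWithinAt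
      · intro y hy
        have hy := interior_subset hy
        rw [(h.hasDerivAt y (hsub hy)).deriv]
        exact mul_nonpos_of_nonpos_of_nonneg (sub_nonpos.2 hy.2.le) (hb y (hsub hy) (hsJ hy))
    have hne : (𝓝[Ico x α] α).NeBot := by
      rw [nhdsWithin_Ico_eq_nhdsLT hlt]; infer_instance
    refine le_of_tendsto (h.tendsto.mono_left (nhdsWithin_mono α hsub)) ?_
    filter_upwards [self_mem_nhdsWithin] with y hy using hm ⟨le_rfl, hlt⟩ hy hy.1

theorem le_of_le (h₁ : IsDivergence b₁ α D₁) (h₂ : IsDivergence b₂ α D₂)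
    (hα : α ∈ Icc (0 : ℝ) 1) {J : Set ℝ} (hJ : J.OrdConnected) (hαJ : α ∈ J)
    (hb : ∀ x ∈ Ioo (0 : ℝ) 1, x ∈ J → b₁ x ≤ b₂ x) {x : ℝ}
    (hx : x ∈ Ioo (0 : ℝ) 1) (hxJ : x ∈ J) : D₁ x ≤ D₂ x :=
  sub_nonneg.1 <| (h₂.sub h₁).nonneg_of_nonneg hα hJ hαJ
    (fun y hy hyJ => sub_nonneg.2 (hb y hy hyJ)) hx hxJ

end IsDivergence

/-! ### The model divergence: relative entropy of two Bernoulli laws. -/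

/-- The divergence of the symplectic potential `GP`. -/
noncomputable def divP (α x : ℝ) : ℝ := GP α - α * Real.log x - (1 - α) * Real.log (1 - x)

theorem isDivergence_divP {α : ℝ} (hα : α ∈ Icc (0 : ℝ) 1) :
    IsDivergence (fun x => 1 / (x * (1 - x))) α (divP α) where
  hasDerivAt x hx := by
    have h0 : x ≠ 0 := hx.1.ne'
    have h1 : 1 - x ≠ 0 := (sub_pos.2 hx.2).ne'
    refine ((((Real.hasDerivAt_log h0).const_mul α).const_sub (GP α)).sub
      ((((hasDerivAt_id x).const_sub 1).log h1).const_mul (1 - α))).congr_deriv ?_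
    simp only [id]
    field_simp
    ring
  tendsto := by
    have key : ContinuousAt (divP α) α := by
      have e1 : ContinuousAt (fun x : ℝ => α * Real.log x) α := by
        -- At `α = 0` the logarithm is discontinuous, but its coefficient makes the whole term
        -- vanish identically.
        rcases eq_or_ne α 0 with rfl | h
        · simpa using continuousAt_const
        · exact (Real.continuousAt_log h).const_mul α
      have e2 : ContinuousAt (fun x : ℝ => (1 - α) * Real.log (1 - x)) α := by
        rcases eq_or_ne (1 - α) 0 with h | h
        · simpa [h] using continuousAt_const
        · exact ((continuousAt_const.sub continuousAt_id).log h).const_mul (1 - α)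
      exact (continuousAt_const.sub e1).sub e2
    have : divP α α = 0 := by simp [divP, GP]
    simpa [ContinuousAt, this] using key.tendsto.mono_left nhdsWithin_le_nhds

theorem four_le_one_div {x : ℝ} (hx : x ∈ Ioo (0 : ℝ) 1) : 4 ≤ 1 / (x * (1 - x)) := by
  have : 0 < x * (1 - x) := mul_pos hx.1 (sub_pos.2 hx.2)
  rw [le_div_iff₀ this]
  nlinarith [sq_nonneg (2 * x - 1)]

/-- Pinsker's inequality, from `GP'' ≥ 4`; it controls the points far from `α`. -/
theorem two_mul_sq_le_divP {α x : ℝ} (hα : α ∈ Icc (0 : ℝ) 1) (hx : x ∈ Ioo (0 : ℝ) 1) :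
    2 * (x - α) ^ 2 ≤ divP α x := by
  have := (IsDivergence.quadratic 4 α).le_of_le (isDivergence_divP hα) hα ordConnected_univ
    (mem_univ α) (fun y hy _ => four_le_one_div hy) hx (mem_univ x)
  linarith

theorem divP_nonneg {α x : ℝ} (hα : α ∈ Icc (0 : ℝ) 1) (hx : x ∈ Ioo (0 : ℝ) 1) :
    0 ≤ divP α x := le_trans (by positivity) (two_mul_sq_le_divP hα hx)

theorem mul_log_convex_comb {a x s : ℝ} (ha : 0 ≤ a) (hx : 0 < x) (hs0 : 0 ≤ s) (hs1 : s ≤ 1) :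
    a * ((1 - s) * Real.log a + s * Real.log x) ≤ a * Real.log ((1 - s) * a + s * x) := by
  rcases ha.eq_or_lt with rfl | ha
  · simp
  · refine mul_le_mul_of_nonneg_left ?_ ha.le
    simpa using strictConcaveOn_log_Ioi.concaveOn.2 (mem_Ioi.2 ha) (mem_Ioi.2 hx)
      (sub_nonneg.2 hs1) hs0 (by ring)

/-- `divP α` is convex, by concavity of the logarithm, and vanishes at `α`. -/
theorem divP_contract {α x s : ℝ} (hα : α ∈ Icc (0 : ℝ) 1) (hx : x ∈ Ioo (0 : ℝ) 1)
    (hs0 : 0 ≤ s) (hs1 : s ≤ 1) : divP α ((1 - s) * α + s * x) ≤ s * divP α x := by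
  have h1 := mul_log_convex_comb hα.1 hx.1 hs0 hs1
  have h2 := mul_log_convex_comb (sub_nonneg.2 hα.2) (sub_pos.2 hx.2) hs0 hs1
  have e : (1 - s) * (1 - α) + s * (1 - x) = 1 - ((1 - s) * α + s * x) := by ring
  rw [e] at h2
  simp only [divP, GP]
  nlinarith

/-! ### Laplace integrals and the scaling inequality for the model. -/

/-- The Laplace integral of `D` over `(0, 1)`. -/
noncomputable def laplaceInt (D : ℝ → ℝ) (l : ℝ) : ℝ := ∫ x in Ioo (0 : ℝ) 1, Real.exp (-(l * D x))

theorem integrableOn_exp_neg {D : ℝ → ℝ} (hc : ContinuousOn D (Ioo 0 1))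
    (h0 : ∀ x ∈ Ioo (0 : ℝ) 1, 0 ≤ D x) {l : ℝ} (hl : 0 ≤ l) :
    IntegrableOn (fun x => Real.exp (-(l * D x))) (Ioo 0 1) := by
  have hfin : volume (Ioo (0 : ℝ) 1) < ⊤ := by simp
  refine IntegrableOn.of_bound hfin ?_ 1 ?_
  · exact ((hc.const_smul l).neg.rexp).aestronglyMeasurable measurableSet_Ioo
  · filter_upwards [ae_restrict_mem measurableSet_Ioo] with x hx
    rw [Real.norm_eq_abs, Real.abs_exp, Real.exp_le_one_iff]
    have := mul_nonneg hl (h0 x hx)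
    linarith

theorem laplaceInt_pos {D : ℝ → ℝ} (hc : ContinuousOn D (Ioo 0 1))
    (h0 : ∀ x ∈ Ioo (0 : ℝ) 1, 0 ≤ D x) {l : ℝ} (hl : 0 ≤ l) : 0 < laplaceInt D l := by
  have : NeZero (volume.restrict (Ioo (0 : ℝ) 1)) := ⟨by simp⟩
  exact integral_exp_pos (integrableOn_exp_neg hc h0 hl)

theorem integrableOn_exp_neg_divP {α : ℝ} (hα : α ∈ Icc (0 : ℝ) 1) {l : ℝ} (hl : 0 ≤ l) :
    IntegrableOn (fun x => Real.exp (-(l * divP α x))) (Ioo 0 1) :=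
  integrableOn_exp_neg (isDivergence_divP hα).continuousOn (fun _ hx => divP_nonneg hα hx) hl

theorem laplaceInt_divP_pos {α : ℝ} (hα : α ∈ Icc (0 : ℝ) 1) {l : ℝ} (hl : 0 ≤ l) :
    0 < laplaceInt (divP α) l :=
  laplaceInt_pos (isDivergence_divP hα).continuousOn (fun _ hx => divP_nonneg hα hx) hl

/-- The substitution `x ↦ (1 - s) α + s x` maps `(0, 1)` into itself with Jacobian `s`, and
`divP_contract` bounds the exponent. No constant depends on `α`, so the estimate is uniform up to
the end points. -/
theorem mul_laplaceInt_divP_le {α : ℝ} (hα : α ∈ Icc (0 : ℝ) 1) {l s : ℝ} (hl : 0 ≤ l)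
    (hs0 : 0 < s) (hs1 : s ≤ 1) :
    s * laplaceInt (divP α) (s * l) ≤ laplaceInt (divP α) l := by
  set f : ℝ → ℝ := fun x => Real.exp (-(l * divP α x)) with hf
  have hsub : Ioo ((1 - s) * α) ((1 - s) * α + s) ⊆ Ioo (0 : ℝ) 1 := by
    intro x hx
    have h1 : 0 ≤ (1 - s) * α := mul_nonneg (sub_nonneg.2 hs1) hα.1
    have h2 : (1 - s) * α ≤ (1 - s) * 1 :=
      mul_le_mul_of_nonneg_left hα.2 (sub_nonneg.2 hs1)
    exact ⟨h1.trans_lt hx.1, hx.2.trans_le (by linarith)⟩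
  have hi := integrableOn_exp_neg_divP hα hl
  have hmaps : ∀ x ∈ Ioo (0 : ℝ) 1,
      (1 - s) * α + s * x ∈ Ioo ((1 - s) * α) ((1 - s) * α + s) := fun x hx =>
    ⟨by nlinarith [hx.1], by nlinarith [hx.2]⟩
  have e : s * ∫ x in Ioo (0 : ℝ) 1, f ((1 - s) * α + s * x) =
      ∫ x in Ioo ((1 - s) * α) ((1 - s) * α + s), f x := by
    have := intervalIntegral.integral_comp_add_mul (a := 0) (b := 1) f hs0.ne' ((1 - s) * α)
    rw [intervalIntegral.integral_of_le zero_le_one, intervalIntegral.integral_of_le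
      (by nlinarith), integral_Ioc_eq_integral_Ioo, integral_Ioc_eq_integral_Ioo] at this
    rw [this, smul_eq_mul, mul_inv_cancel_left₀ hs0.ne']
    simp
  calc s * laplaceInt (divP α) (s * l)
      ≤ s * ∫ x in Ioo (0 : ℝ) 1, f ((1 - s) * α + s * x) := by
        refine mul_le_mul_of_nonneg_left ?_ hs0.le
        refine setIntegral_mono_on (integrableOn_exp_neg_divP hα (by positivity)) ?_
          measurableSet_Ioo ?_
        · have hc : ContinuousOn (fun x => divP α ((1 - s) * α + s * x)) (Ioo 0 1) :=
            (isDivergence_divP hα).continuousOn.comp (by fun_prop)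
              fun x hx => hsub (hmaps x hx)
          exact integrableOn_exp_neg hc (fun x hx => divP_nonneg hα (hsub (hmaps x hx))) hl
        · intro x hx
          have := mul_le_mul_of_nonneg_left (divP_contract hα hx hs0.le hs1) hl
          exact Real.exp_le_exp.2 (by linarith)
    _ = ∫ x in Ioo ((1 - s) * α) ((1 - s) * α + s), f x := e
    _ ≤ laplaceInt (divP α) l :=
        setIntegral_mono_set hi (ae_of_all _ fun x => (Real.exp_pos _).le) hsub.eventuallyLE

theorem laplaceInt_divP_div_le {α : ℝ} (hα : α ∈ Icc (0 : ℝ) 1) {l S : ℝ} (hl : 0 ≤ l)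
    (hS : 1 ≤ S) : laplaceInt (divP α) l / S ≤ laplaceInt (divP α) (S * l) := by
  have hS0 : 0 < S := by linarith
  have := mul_laplaceInt_divP_le hα (mul_nonneg hS0.le hl) (inv_pos.2 hS0) (inv_le_one_of_one_le₀ hS)
  rw [inv_mul_cancel_left₀ hS0.ne'] at this
  rwa [div_eq_inv_mul]

/-! ### Comparison with the model when the Hessian ratio `Γ` is pinched. -/

section Compare

variable {Γ : ℝ → ℝ} {α₀ α δ m M s S : ℝ} {D : ℝ → ℝ}

theorem mul_divP_le (hα : α ∈ Icc (0 : ℝ) 1)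
    (hD : IsDivergence (fun x => Γ x / (x * (1 - x))) α D) {J : Set ℝ} (hJ : J.OrdConnected)
    (hαJ : α ∈ J) (h : ∀ x ∈ Ioo (0 : ℝ) 1, x ∈ J → m ≤ Γ x) {x : ℝ} (hx : x ∈ Ioo (0 : ℝ) 1)
    (hxJ : x ∈ J) : m * divP α x ≤ D x := by
  refine ((isDivergence_divP hα).const_mul m).le_of_le hD hα hJ hαJ (fun y hy hyJ => ?_) hx hxJ
  have : 0 < y * (1 - y) := mul_pos hy.1 (sub_pos.2 hy.2)
  rw [mul_one_div]
  exact div_le_div_of_nonneg_right (h y hy hyJ) this.le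

theorem le_mul_divP (hα : α ∈ Icc (0 : ℝ) 1)
    (hD : IsDivergence (fun x => Γ x / (x * (1 - x))) α D) {J : Set ℝ} (hJ : J.OrdConnected)
    (hαJ : α ∈ J) (h : ∀ x ∈ Ioo (0 : ℝ) 1, x ∈ J → Γ x ≤ M) {x : ℝ} (hx : x ∈ Ioo (0 : ℝ) 1)
    (hxJ : x ∈ J) : D x ≤ M * divP α x := by
  refine hD.le_of_le ((isDivergence_divP hα).const_mul M) hα hJ hαJ (fun y hy hyJ => ?_) hx hxJ
  have : 0 < y * (1 - y) := mul_pos hy.1 (sub_pos.2 hy.2)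
  rw [mul_one_div]
  exact div_le_div_of_nonneg_right (h y hy hyJ) this.le

theorem IsDivergence.nonneg (hα : α ∈ Icc (0 : ℝ) 1)
    (hD : IsDivergence (fun x => Γ x / (x * (1 - x))) α D) (hm : 0 ≤ m)
    (h : ∀ x ∈ Ioo (0 : ℝ) 1, m ≤ Γ x) {x : ℝ} (hx : x ∈ Ioo (0 : ℝ) 1) : 0 ≤ D x :=
  (mul_nonneg hm (divP_nonneg hα hx)).trans
    (mul_divP_le hα hD ordConnected_univ (mem_univ _) (fun y hy _ => h y hy) hx (mem_univ _))

/-- Upper bound for a Laplace integral by that of `divP`, the error being the contribution of the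
points away from `α₀`. -/
theorem laplaceInt_le_of_near (hα : α ∈ Icc (0 : ℝ) 1)
    (hD : IsDivergence (fun x => Γ x / (x * (1 - x))) α D) (hm : 0 < m) (hm1 : m ≤ 1)
    (hΓ : ∀ x ∈ Ioo (0 : ℝ) 1, m ≤ Γ x) (hs : 0 < s) (hs1 : s ≤ 1) (hδ : 0 ≤ δ)
    (hnear : ∀ x ∈ Ioo (0 : ℝ) 1, x ∈ Metric.ball α₀ (2 * δ) → s ≤ Γ x)
    (hαδ : α ∈ Metric.ball α₀ δ) {l : ℝ} (hl : 0 ≤ l) :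
    laplaceInt D l ≤ (1 / s + 2 / m * Real.exp (-(l * (m * δ ^ 2)))) * laplaceInt (divP α) l := by
  have hα2 : α ∈ Metric.ball α₀ (2 * δ) := Metric.ball_subset_ball (by linarith) hαδ
  set E := Real.exp (-(l * (m * δ ^ 2))) with hE
  have i1 : IntegrableOn (fun x => Real.exp (-((s * l) * divP α x))) (Ioo 0 1) :=
    integrableOn_exp_neg_divP hα (by positivity)
  have i2 : IntegrableOn (fun x => E * Real.exp (-((m / 2 * l) * divP α x))) (Ioo 0 1) :=
    (integrableOn_exp_neg_divP hα (by positivity)).const_mul E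
  have i0 : IntegrableOn (fun x => Real.exp (-(l * D x))) (Ioo 0 1) :=
    integrableOn_exp_neg hD.continuousOn (fun x hx => hD.nonneg hα hm.le hΓ hx) hl
  have h1 : laplaceInt D l ≤
      laplaceInt (divP α) (s * l) + E * laplaceInt (divP α) (m / 2 * l) := by
    unfold laplaceInt
    rw [← integral_const_mul, ← integral_add i1 i2]
    refine setIntegral_mono_on i0 (i1.add i2) measurableSet_Ioo fun x hx => ?_
    by_cases hxn : x ∈ Metric.ball α₀ (2 * δ)
    · have := mul_divP_le hα hD (convex_ball α₀ (2 * δ)).ordConnected hα2 hnear hx hxn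
      have := mul_le_mul_of_nonneg_left this hl
      have e : Real.exp (-(l * D x)) ≤ Real.exp (-(s * l * divP α x)) :=
        Real.exp_le_exp.2 (by linarith)
      exact e.trans (le_add_of_nonneg_right (by positivity))
    · have hD1 := mul_divP_le hα hD ordConnected_univ (mem_univ _) (fun y hy _ => hΓ y hy) hx
        (mem_univ x)
      have hfar : δ ^ 2 ≤ (x - α) ^ 2 := by
        rw [Metric.mem_ball, not_lt] at hxn
        rw [Metric.mem_ball] at hαδ
        have := dist_triangle x α α₀
        rw [Real.dist_eq x α] at this
        rw [← sq_abs (x - α)]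
        exact pow_le_pow_left₀ hδ (by linarith) 2
      have hP := two_mul_sq_le_divP hα hx
      -- Half of `m * divP α x` yields the gain `m * δ ^ 2` by Pinsker; the other half keeps a
      -- Laplace integral that the scaling inequality compares with that of exponent `l`.
      have : m * δ ^ 2 + m / 2 * divP α x ≤ D x := by nlinarith
      have := mul_le_mul_of_nonneg_left this hl
      have e : Real.exp (-(l * D x)) ≤ E * Real.exp (-(m / 2 * l * divP α x)) := by
        rw [hE, ← Real.exp_add]
        exact Real.exp_le_exp.2 (by linarith)
      exact e.trans (le_add_of_nonneg_left (by positivity))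
  have h2 := mul_laplaceInt_divP_le hα hl hs hs1
  have h3 := mul_laplaceInt_divP_le (s := m / 2) hα hl (by positivity) (by linarith)
  have h2' : laplaceInt (divP α) (s * l) ≤ 1 / s * laplaceInt (divP α) l := by
    rw [one_div, ← div_eq_inv_mul, le_div_iff₀ hs]; linarith
  have h3' : laplaceInt (divP α) (m / 2 * l) ≤ 2 / m * laplaceInt (divP α) l := by
    have e : 2 / m = (m / 2)⁻¹ := by field_simp
    rw [e, ← div_eq_inv_mul, le_div_iff₀ (by positivity)]; linarith
  have h4 := mul_le_mul_of_nonneg_left h3' (Real.exp_pos (-(l * (m * δ ^ 2)))).le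
  rw [← hE] at h4
  linarith

/-- Lower bound for a Laplace integral by that of `divP`, the error being the contribution of the
points away from `α₀`. -/
theorem le_laplaceInt_of_near (hα : α ∈ Icc (0 : ℝ) 1)
    (hD : IsDivergence (fun x => Γ x / (x * (1 - x))) α D) (hm : 0 ≤ m)
    (hΓ : ∀ x ∈ Ioo (0 : ℝ) 1, m ≤ Γ x) (hS : 1 ≤ S) (hδ : 0 ≤ δ)
    (hnear : ∀ x ∈ Ioo (0 : ℝ) 1, x ∈ Metric.ball α₀ (2 * δ) → Γ x ≤ S)
    (hαδ : α ∈ Metric.ball α₀ δ) {l : ℝ} (hl : 0 ≤ l) :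
    (1 / S - 2 * Real.exp (-(l * δ ^ 2))) * laplaceInt (divP α) l ≤ laplaceInt D l := by
  have hα2 : α ∈ Metric.ball α₀ (2 * δ) := Metric.ball_subset_ball (by linarith) hαδ
  set E := Real.exp (-(l * δ ^ 2)) with hE
  have i1 : IntegrableOn (fun x => Real.exp (-((S * l) * divP α x))) (Ioo 0 1) :=
    integrableOn_exp_neg_divP hα (by positivity)
  have i2 : IntegrableOn (fun x => E * Real.exp (-((1 / 2 * l) * divP α x))) (Ioo 0 1) :=
    (integrableOn_exp_neg_divP hα (by positivity)).const_mul E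
  have i0 : IntegrableOn (fun x => Real.exp (-(l * D x))) (Ioo 0 1) :=
    integrableOn_exp_neg hD.continuousOn (fun x hx => hD.nonneg hα hm hΓ hx) hl
  have h1 : laplaceInt (divP α) (S * l) ≤
      laplaceInt D l + E * laplaceInt (divP α) (1 / 2 * l) := by
    unfold laplaceInt
    rw [← integral_const_mul, ← integral_add i0 i2]
    refine setIntegral_mono_on i1 (i0.add i2) measurableSet_Ioo fun x hx => ?_
    by_cases hxn : x ∈ Metric.ball α₀ (2 * δ)
    · have := le_mul_divP hα hD (convex_ball α₀ (2 * δ)).ordConnected hα2 hnear hx hxn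
      have := mul_le_mul_of_nonneg_left this hl
      have e : Real.exp (-(S * l * divP α x)) ≤ Real.exp (-(l * D x)) :=
        Real.exp_le_exp.2 (by linarith)
      exact e.trans (le_add_of_nonneg_right (by positivity))
    · have hfar : δ ^ 2 ≤ (x - α) ^ 2 := by
        rw [Metric.mem_ball, not_lt] at hxn
        rw [Metric.mem_ball] at hαδ
        have := dist_triangle x α α₀
        rw [Real.dist_eq x α] at this
        rw [← sq_abs (x - α)]
        exact pow_le_pow_left₀ hδ (by linarith) 2
      have hP := two_mul_sq_le_divP hα hx
      -- Since `S ≥ 1`, one half of `divP α x` gives `δ ^ 2` and another half is left over.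
      have : δ ^ 2 + 1 / 2 * divP α x ≤ S * divP α x := by nlinarith [divP_nonneg hα hx]
      have := mul_le_mul_of_nonneg_left this hl
      have e : Real.exp (-(S * l * divP α x)) ≤ E * Real.exp (-(1 / 2 * l * divP α x)) := by
        rw [hE, ← Real.exp_add]
        exact Real.exp_le_exp.2 (by linarith)
      exact e.trans (le_add_of_nonneg_left (by positivity))
  have h2 := laplaceInt_divP_div_le hα hl hS
  have h3 := mul_laplaceInt_divP_le (s := 1 / 2) hα hl (by norm_num) (by norm_num)
  have h4 := mul_le_mul_of_nonneg_left h3 (Real.exp_pos (-(l * δ ^ 2))).le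
  rw [← hE] at h4
  have e : 1 / S * laplaceInt (divP α) l = laplaceInt (divP α) l / S := by ring
  rw [sub_mul, e]
  linarith

/-- Here `m * divP α ≤ D ≤ M * divP α` on all of `(0, 1)`, and the scaling inequality moves the
factors `m` and `M` out of the exponent. -/
theorem laplaceInt_ratio_bounds (hα : α ∈ Icc (0 : ℝ) 1)
    (hD : IsDivergence (fun x => Γ x / (x * (1 - x))) α D) (hm : 0 < m) (hm1 : m ≤ 1)
    (hM1 : 1 ≤ M) (hΓ : ∀ x ∈ Ioo (0 : ℝ) 1, m ≤ Γ x) (hΓM : ∀ x ∈ Ioo (0 : ℝ) 1, Γ x ≤ M)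
    {l : ℝ} (hl : 0 ≤ l) :
    1 / M ≤ laplaceInt D l / laplaceInt (divP α) l ∧
      laplaceInt D l / laplaceInt (divP α) l ≤ 1 / m := by
  have hJ := laplaceInt_divP_pos hα hl
  have i0 : IntegrableOn (fun x => Real.exp (-(l * D x))) (Ioo 0 1) :=
    integrableOn_exp_neg hD.continuousOn (fun x hx => hD.nonneg hα hm.le hΓ hx) hl
  constructor
  · rw [le_div_iff₀ hJ, one_div_mul_eq_div]
    refine (laplaceInt_divP_div_le hα hl hM1).trans ?_
    refine setIntegral_mono_on (integrableOn_exp_neg_divP hα (by positivity)) i0 measurableSet_Ioo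
      fun x hx => Real.exp_le_exp.2 ?_
    have := mul_le_mul_of_nonneg_left (le_mul_divP hα hD ordConnected_univ (mem_univ _)
      (fun y hy _ => hΓM y hy) hx (mem_univ x)) hl
    linarith
  · rw [div_le_iff₀ hJ, one_div_mul_eq_div, le_div_iff₀ hm]
    refine le_trans ?_ (mul_laplaceInt_divP_le hα hl hm hm1)
    rw [mul_comm]
    refine mul_le_mul_of_nonneg_left ?_ hm.le
    refine setIntegral_mono_on i0 (integrableOn_exp_neg_divP hα (by positivity)) measurableSet_Ioo
      fun x hx => Real.exp_le_exp.2 ?_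
    have := mul_le_mul_of_nonneg_left (mul_divP_le hα hD ordConnected_univ (mem_univ _)
      (fun y hy _ => hΓ y hy) hx (mem_univ x)) hl
    linarith

end Compare

/-! ### Limits of Laplace integrals, jointly in `N` and `α`. -/

section Limits

variable {Γ : ℝ → ℝ} {α₀ m : ℝ} {D : ℝ → ℝ → ℝ}

theorem tendsto_exp_neg_natCast_mul {c : ℝ} (hc : 0 < c) (F : Filter ℝ) :
    Tendsto (fun p : ℕ × ℝ => Real.exp (-((p.1 : ℝ) * c))) (atTop ×ˢ F) (𝓝 0) :=
  Real.tendsto_exp_neg_atTop_nhds_zero.comp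
    ((tendsto_natCast_atTop_atTop.comp tendsto_fst).atTop_mul_const hc)

theorem exists_near_Ioo {Γ : ℝ → ℝ} {α₀ s S : ℝ} (hΓc : ContinuousWithinAt Γ (Icc 0 1) α₀)
    (hs : s < Γ α₀) (hS : Γ α₀ < S) :
    ∃ δ > 0, ∀ x ∈ Icc (0 : ℝ) 1, x ∈ Metric.ball α₀ (2 * δ) → s ≤ Γ x ∧ Γ x ≤ S := by
  have h1 : ∀ᶠ x in 𝓝[Icc 0 1] α₀, Γ x ∈ Ioo s S := hΓc (Ioo_mem_nhds hs hS)
  obtain ⟨δ, hδ, h⟩ := Metric.mem_nhdsWithin_iff.1 h1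
  refine ⟨δ / 2, by positivity, fun x hx hxb => ?_⟩
  have := h ⟨by rwa [mul_div_cancel₀ δ two_ne_zero] at hxb, hx⟩
  exact ⟨this.1.le, this.2.le⟩

/-- Comparison loses factors `1 / s` and `1 / S` where the true answer is a square root, so it is
sharp only where `Γ = 1`. That suffices at the end points, where the Hessian blows up and no
Gaussian rescaling is available. -/
theorem tendsto_laplaceInt_ratio_of_eq_one (hα₀ : α₀ ∈ Icc (0 : ℝ) 1)
    (hD : ∀ α ∈ Icc (0 : ℝ) 1, IsDivergence (fun x => Γ x / (x * (1 - x))) α (D α))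
    (hm : 0 < m) (hΓ : ∀ x ∈ Icc (0 : ℝ) 1, m ≤ Γ x)
    (hΓc : ContinuousWithinAt Γ (Icc 0 1) α₀) (h1 : Γ α₀ = 1) :
    Tendsto (fun p : ℕ × ℝ => laplaceInt (D p.2) p.1 / laplaceInt (divP p.2) p.1)
      (atTop ×ˢ 𝓝[Icc 0 1] α₀) (𝓝 1) := by
  have hm1 : m ≤ 1 := h1 ▸ hΓ α₀ hα₀
  have hΓ' : ∀ x ∈ Ioo (0 : ℝ) 1, m ≤ Γ x := fun x hx => hΓ x (Ioo_subset_Icc_self hx)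
  have hin : ∀ δ > 0, ∀ᶠ p : ℕ × ℝ in atTop ×ˢ 𝓝[Icc 0 1] α₀,
      p.2 ∈ Icc (0 : ℝ) 1 ∧ p.2 ∈ Metric.ball α₀ δ := fun δ hδ =>
    tendsto_snd.eventually (p := fun x => x ∈ Icc (0 : ℝ) 1 ∧ x ∈ Metric.ball α₀ δ)
      (eventually_mem_nhdsWithin.and (mem_nhdsWithin_of_mem_nhds (Metric.ball_mem_nhds α₀ hδ)))
  refine tendsto_order.2 ⟨fun a ha => ?_, fun a ha => ?_⟩
  · obtain ⟨S, hS1, hS⟩ : ∃ S > 1, a < 1 / S := by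
      have : Tendsto (fun S : ℝ => 1 / S) (𝓝[>] 1) (𝓝 (1 / 1)) :=
        ((continuousAt_const.div continuousAt_id one_ne_zero).tendsto).mono_left
          nhdsWithin_le_nhds
      have := (this.eventually (lt_mem_nhds (by simpa using ha))).and self_mem_nhdsWithin
      obtain ⟨S, h, hS⟩ := this.exists
      exact ⟨S, hS, h⟩
    -- Only the bound `Γ ≤ S` is used here; `0` is just some number below `Γ α₀ = 1`.
    obtain ⟨δ, hδ, hn⟩ := exists_near_Ioo (s := 0) hΓc (by linarith) (h1.trans_lt hS1)
    have hlim := ((tendsto_exp_neg_natCast_mul (pow_pos hδ 2) (𝓝[Icc 0 1] α₀)).const_mul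
      2).const_sub (1 / S)
    rw [mul_zero, sub_zero] at hlim
    filter_upwards [hlim.eventually (lt_mem_nhds hS), hin δ hδ] with p hp hpα
    refine hp.trans_le ?_
    rw [le_div_iff₀ (laplaceInt_divP_pos hpα.1 (Nat.cast_nonneg p.1))]
    exact le_laplaceInt_of_near hpα.1 (hD _ hpα.1) hm.le hΓ' hS1.le hδ.le
      (fun x hx hxb => (hn x (Ioo_subset_Icc_self hx) hxb).2) hpα.2 (Nat.cast_nonneg _)
  · obtain ⟨s, ⟨hs0, hs1⟩, hs⟩ : ∃ s ∈ Ioo (0 : ℝ) 1, 1 / s < a := by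
      have : Tendsto (fun S : ℝ => 1 / S) (𝓝[<] 1) (𝓝 (1 / 1)) :=
        ((continuousAt_const.div continuousAt_id one_ne_zero).tendsto).mono_left
          nhdsWithin_le_nhds
      have := (this.eventually (gt_mem_nhds (by simpa using ha))).and
        (Ioo_mem_nhdsLT (zero_lt_one (α := ℝ)))
      obtain ⟨S, h, hS⟩ := this.exists
      exact ⟨S, hS, h⟩
    obtain ⟨δ, hδ, hn⟩ := exists_near_Ioo (S := 2) hΓc (hs1.trans_eq h1.symm) (by linarith)
    have hlim := ((tendsto_exp_neg_natCast_mul (mul_pos hm (pow_pos hδ 2))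
      (𝓝[Icc 0 1] α₀)).const_mul (2 / m)).const_add (1 / s)
    rw [mul_zero, add_zero] at hlim
    filter_upwards [hlim.eventually (gt_mem_nhds hs), hin δ hδ] with p hp hpα
    refine lt_of_le_of_lt ?_ hp
    rw [div_le_iff₀ (laplaceInt_divP_pos hpα.1 (Nat.cast_nonneg p.1))]
    exact laplaceInt_le_of_near hpα.1 (hD _ hpα.1) hm hm1 hΓ' hs0 hs1.le hδ.le
      (fun x hx hxb => (hn x (Ioo_subset_Icc_self hx) hxb).1) hpα.2 (Nat.cast_nonneg _)

/-- The substitution `x = α + y / √N`; the indicator puts all the integrals on the fixed domain `ℝ`.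
-/
theorem sqrt_mul_laplaceInt (E : ℝ → ℝ) (α : ℝ) (N : ℕ) (hN : 0 < N) :
    √N * laplaceInt E N =
      ∫ y : ℝ, (Ioo (0 : ℝ) 1).indicator (fun x => Real.exp (-(N * E x))) (α + y / √N) := by
  have hN' : (0 : ℝ) < √N := Real.sqrt_pos.2 (by exact_mod_cast hN)
  rw [Measure.integral_comp_div
    (fun u => (Ioo (0 : ℝ) 1).indicator (fun x => Real.exp (-(N * E x))) (α + u)),
    integral_add_left_eq_self, integral_indicator measurableSet_Ioo, abs_of_pos hN', smul_eq_mul]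
  rfl

/-- Laplace's method at an interior point, locally uniformly in the point. -/
theorem tendsto_sqrt_mul_laplaceInt (hα₀ : α₀ ∈ Ioo (0 : ℝ) 1)
    (hD : ∀ α ∈ Icc (0 : ℝ) 1, IsDivergence (fun x => Γ x / (x * (1 - x))) α (D α))
    (hm : 0 < m) (hΓ : ∀ x ∈ Icc (0 : ℝ) 1, m ≤ Γ x)
    (hΓc : ContinuousWithinAt Γ (Icc 0 1) α₀) :
    Tendsto (fun p : ℕ × ℝ => √p.1 * laplaceInt (D p.2) p.1)
      (atTop ×ˢ 𝓝[Icc 0 1] α₀) (𝓝 (√(Real.pi / (Γ α₀ / (α₀ * (1 - α₀)) / 2)))) := by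
  set b : ℝ → ℝ := fun x => Γ x / (x * (1 - x)) with hb
  have hbc : ContinuousAt b α₀ := by
    have h1 : ContinuousAt Γ α₀ := hΓc.continuousAt (Icc_mem_nhds hα₀.1 hα₀.2)
    exact h1.div (by fun_prop) (mul_pos hα₀.1 (sub_pos.2 hα₀.2)).ne'
  have hbm : ∀ x ∈ Ioo (0 : ℝ) 1, 4 * m ≤ b x := fun x hx => by
    have h1 := four_le_one_div hx
    have h2 := hΓ x (Ioo_subset_Icc_self hx)
    calc 4 * m ≤ 1 / (x * (1 - x)) * m := mul_le_mul_of_nonneg_right h1 hm.le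
      _ ≤ 1 / (x * (1 - x)) * Γ x := mul_le_mul_of_nonneg_left h2 (by linarith)
      _ = b x := by rw [hb]; ring
  -- After rescaling, this gives the dominating Gaussian `exp (-2 m y ^ 2)`, independent of `N` and
  -- `α`.
  have hDlow : ∀ α ∈ Icc (0 : ℝ) 1, ∀ x ∈ Ioo (0 : ℝ) 1, 2 * m * (x - α) ^ 2 ≤ D α x := by
    intro α hα x hx
    have := (IsDivergence.quadratic (4 * m) α).le_of_le (hD α hα) hα ordConnected_univ
      (mem_univ α) (fun y hy _ => hbm y hy) hx (mem_univ x)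
    linarith
  set F : ℕ × ℝ → ℝ → ℝ := fun p y =>
    (Ioo (0 : ℝ) 1).indicator (fun x => Real.exp (-(p.1 * D p.2 x))) (p.2 + y / √p.1) with hF
  have hpos : ∀ᶠ p : ℕ × ℝ in atTop ×ˢ 𝓝[Icc 0 1] α₀, 0 < p.1 ∧ p.2 ∈ Icc (0 : ℝ) 1 :=
    (tendsto_fst.eventually (eventually_gt_atTop 0)).and
      (tendsto_snd.eventually eventually_mem_nhdsWithin)
  have hsnd : Tendsto (fun p : ℕ × ℝ => p.2) (atTop ×ˢ 𝓝[Icc 0 1] α₀) (𝓝 α₀) :=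
    tendsto_snd.mono_right nhdsWithin_le_nhds
  have hmain : Tendsto (fun p => ∫ y, F p y) (atTop ×ˢ 𝓝[Icc 0 1] α₀)
      (𝓝 (∫ y, Real.exp (-(b α₀ / 2) * y ^ 2))) := by
    refine tendsto_integral_filter_of_dominated_convergence
      (fun y => Real.exp (-(2 * m) * y ^ 2)) ?_ ?_ (integrable_exp_neg_mul_sq (by positivity)) ?_
    · filter_upwards [hpos] with p hp
      have hc : ContinuousOn (fun x => Real.exp (-(p.1 * D p.2 x))) (Ioo 0 1) :=
        ((hD _ hp.2).continuousOn.const_smul (p.1 : ℝ)).neg.rexp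
      have hmeas : Measurable ((Ioo (0 : ℝ) 1).indicator fun x => Real.exp (-(p.1 * D p.2 x))) := by
        classical
        rw [← Set.piecewise_eq_indicator]
        exact hc.measurable_piecewise continuousOn_const measurableSet_Ioo
      exact (hmeas.comp (by fun_prop)).aestronglyMeasurable
    · filter_upwards [hpos] with p hp
      refine ae_of_all _ fun y => ?_
      have hN : (0 : ℝ) < p.1 := by exact_mod_cast hp.1
      by_cases hy : p.2 + y / √p.1 ∈ Ioo (0 : ℝ) 1
      · simp only [hF, indicator_of_mem hy, Real.norm_eq_abs, Real.abs_exp]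
        refine Real.exp_le_exp.2 ?_
        have h1 := mul_le_mul_of_nonneg_left (hDlow _ hp.2 _ hy) hN.le
        rw [add_sub_cancel_left, div_pow, Real.sq_sqrt hN.le] at h1
        have h2 : (p.1 : ℝ) * (2 * m * (y ^ 2 / p.1)) = 2 * m * y ^ 2 := by field_simp
        linarith
      · simp only [hF, indicator_of_notMem hy, norm_zero]
        positivity
    · refine ae_of_all _ fun y => ?_
      have hx : Tendsto (fun p : ℕ × ℝ => p.2 + y / √p.1) (atTop ×ˢ 𝓝[Icc 0 1] α₀) (𝓝 α₀) := by
        have : Tendsto (fun p : ℕ × ℝ => y / √p.1) (atTop ×ˢ 𝓝[Icc 0 1] α₀) (𝓝 0) :=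
          ((Real.tendsto_sqrt_atTop.comp tendsto_natCast_atTop_atTop).comp
            tendsto_fst).const_div_atTop y
        simpa using hsnd.add this
      have hlim : Tendsto (fun p : ℕ × ℝ => (p.1 : ℝ) * D p.2 (p.2 + y / √p.1))
          (atTop ×ˢ 𝓝[Icc 0 1] α₀) (𝓝 (b α₀ / 2 * y ^ 2)) := by
        have hsq : ∀ (p : ℕ × ℝ) (κ : ℝ), 0 < p.1 →
            (p.1 : ℝ) * (κ / 2 * (p.2 + y / √p.1 - p.2) ^ 2) = κ / 2 * y ^ 2 := by
          intro p κ hp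
          have hN : (0 : ℝ) < p.1 := by exact_mod_cast hp
          rw [add_sub_cancel_left, div_pow, Real.sq_sqrt hN.le]
          field_simp
        have hcont : ContinuousAt (fun κ : ℝ => κ / 2 * y ^ 2) (b α₀) := by fun_prop
        -- Near `α₀` the Hessian `b` lies between `κ₁` and `κ₂`, so `D` lies between the
        -- corresponding quadratic divergences, whose rescalings do not depend on `N` and `α`.
        have hnear : ∀ κ₁ κ₂ : ℝ, κ₁ < b α₀ → b α₀ < κ₂ →
            ∀ᶠ p : ℕ × ℝ in atTop ×ˢ 𝓝[Icc 0 1] α₀,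
              κ₁ / 2 * y ^ 2 ≤ p.1 * D p.2 (p.2 + y / √p.1) ∧
                p.1 * D p.2 (p.2 + y / √p.1) ≤ κ₂ / 2 * y ^ 2 := by
          intro κ₁ κ₂ h₁ h₂
          obtain ⟨δ, hδ, hball⟩ := Metric.mem_nhds_iff.1
            (inter_mem (hbc (Icc_mem_nhds h₁ h₂)) (Ioo_mem_nhds hα₀.1 hα₀.2))
          have hB := Metric.ball_mem_nhds α₀ hδ
          filter_upwards [hpos, hsnd hB, hx hB] with p hp hpα hpx
          have hN : (0 : ℝ) ≤ p.1 := Nat.cast_nonneg _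
          have hJ := (convex_ball α₀ δ).ordConnected
          constructor
          · rw [← hsq p κ₁ hp.1]
            refine mul_le_mul_of_nonneg_left ?_ hN
            exact (IsDivergence.quadratic κ₁ p.2).le_of_le (hD _ hp.2) hp.2 hJ hpα
              (fun z _ hz => (hball hz).1.1) (hball hpx).2 hpx
          · rw [← hsq p κ₂ hp.1]
            refine mul_le_mul_of_nonneg_left ?_ hN
            exact (hD _ hp.2).le_of_le (IsDivergence.quadratic κ₂ p.2) hp.2 hJ hpα
              (fun z _ hz => (hball hz).1.2) (hball hpx).2 hpx
        refine tendsto_order.2 ⟨fun a ha => ?_, fun a ha => ?_⟩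
        · have h1 : ∀ᶠ κ in 𝓝[<] (b α₀), a < κ / 2 * y ^ 2 :=
            (hcont.tendsto.mono_left nhdsWithin_le_nhds).eventually (lt_mem_nhds ha)
          obtain ⟨κ, h1, h2⟩ := (h1.and self_mem_nhdsWithin).exists
          filter_upwards [hnear κ (b α₀ + 1) h2 (by linarith)] with p hp using h1.trans_le hp.1
        · have h1 : ∀ᶠ κ in 𝓝[>] (b α₀), κ / 2 * y ^ 2 < a :=
            (hcont.tendsto.mono_left nhdsWithin_le_nhds).eventually (gt_mem_nhds ha)
          obtain ⟨κ, h1, h2⟩ := (h1.and self_mem_nhdsWithin).exists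
          filter_upwards [hnear (b α₀ - 1) κ (by linarith) h2] with p hp using hp.2.trans_lt h1
      have hexp := (Real.continuous_exp.tendsto _).comp hlim.neg
      rw [← neg_mul] at hexp
      refine hexp.congr' ?_
      filter_upwards [hx (Ioo_mem_nhds hα₀.1 hα₀.2)] with p hp
      exact (indicator_of_mem (mem_preimage.1 hp)
        fun x => Real.exp (-((p.1 : ℝ) * D p.2 x))).symm
  rw [integral_gaussian] at hmain
  refine hmain.congr' ?_
  filter_upwards [hpos] with p hp
  exact (sqrt_mul_laplaceInt (D p.2) p.2 p.1 hp.1).symm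

/-- In the interior this is the quotient of two Laplace asymptotics, the model being the case `Γ =
1`; the factors `√N` cancel. -/
theorem tendsto_laplaceInt_ratio (hα₀ : α₀ ∈ Icc (0 : ℝ) 1)
    (hD : ∀ α ∈ Icc (0 : ℝ) 1, IsDivergence (fun x => Γ x / (x * (1 - x))) α (D α))
    (hm : 0 < m) (hΓ : ∀ x ∈ Icc (0 : ℝ) 1, m ≤ Γ x)
    (hΓc : ContinuousOn Γ (Icc 0 1)) (h0 : Γ 0 = 1) (h1 : Γ 1 = 1) :
    Tendsto (fun p : ℕ × ℝ => laplaceInt (D p.2) p.1 / laplaceInt (divP p.2) p.1)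
      (atTop ×ˢ 𝓝[Icc 0 1] α₀) (𝓝 (√(1 / Γ α₀))) := by
  rcases hα₀.1.eq_or_lt with rfl | hpos
  · simpa [h0] using tendsto_laplaceInt_ratio_of_eq_one hα₀ hD hm hΓ (hΓc _ hα₀) h0
  rcases hα₀.2.eq_or_lt with rfl | hlt
  · simpa [h1] using tendsto_laplaceInt_ratio_of_eq_one hα₀ hD hm hΓ (hΓc _ hα₀) h1
  have hx : 0 < α₀ * (1 - α₀) := mul_pos hpos (sub_pos.2 hlt)
  have hg : 0 < Γ α₀ := hm.trans_le (hΓ _ hα₀)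
  have l1 := tendsto_sqrt_mul_laplaceInt ⟨hpos, hlt⟩ hD hm hΓ (hΓc _ hα₀)
  have l2 := tendsto_sqrt_mul_laplaceInt (Γ := fun _ => 1) (D := divP) ⟨hpos, hlt⟩
    (fun α hα => isDivergence_divP hα) one_pos (fun _ _ => le_rfl) continuousWithinAt_const
  have l3 := l1.div l2 (by have := Real.pi_pos; positivity)
  rw [← Real.sqrt_div' _ (by have := Real.pi_pos; positivity)] at l3
  have e : Real.pi / (Γ α₀ / (α₀ * (1 - α₀)) / 2) / (Real.pi / (1 / (α₀ * (1 - α₀)) / 2)) =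
      1 / Γ α₀ := by
    have := Real.pi_pos.ne'
    have := hx.ne'
    field_simp
  rw [e] at l3
  refine l3.congr' ?_
  filter_upwards [tendsto_fst.eventually (eventually_gt_atTop 0)] with p hp
  have : (0 : ℝ) < √p.1 := Real.sqrt_pos.2 (by exact_mod_cast hp)
  simp only [Pi.div_apply]
  rw [mul_div_mul_left _ _ this.ne']

theorem tendstoUniformlyOn_laplaceInt_ratio
    (hD : ∀ α ∈ Icc (0 : ℝ) 1, IsDivergence (fun x => Γ x / (x * (1 - x))) α (D α))
    (hm : 0 < m) (hΓ : ∀ x ∈ Icc (0 : ℝ) 1, m ≤ Γ x)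
    (hΓc : ContinuousOn Γ (Icc 0 1)) (h0 : Γ 0 = 1) (h1 : Γ 1 = 1) :
    ContinuousOn (fun α => √(1 / Γ α)) (Icc 0 1) ∧
      TendstoUniformlyOn (fun (N : ℕ) α => laplaceInt (D α) N / laplaceInt (divP α) N)
        (fun α => √(1 / Γ α)) atTop (Icc 0 1) := by
  have hc : ContinuousOn (fun α => √(1 / Γ α)) (Icc 0 1) :=
    (continuousOn_const.div hΓc fun x hx => (hm.trans_le (hΓ x hx)).ne').sqrt
  refine ⟨hc, ?_⟩
  rw [← tendstoLocallyUniformlyOn_iff_tendstoUniformlyOn_of_compact isCompact_Icc,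
    tendstoLocallyUniformlyOn_iff_forall_tendsto]
  intro α hα
  refine (Tendsto.prodMk_nhds ((hc α hα).tendsto.comp tendsto_snd)
    (tendsto_laplaceInt_ratio hα hD hm hΓ hΓc h0 h1)).mono_right ?_
  exact nhds_le_uniformity _

end Limits

/-! ### The moment map `U'` of a toric metric and its inverse. -/

theorem deriv_deriv_comp_log_sq {V : ℝ → ℝ} (hV : ContDiff ℝ ∞ V) (a c : ℝ)
    (h0 : 0 < a ^ 2 + c) :
    deriv (deriv fun t : ℝ => V (Real.log ((a + t) ^ 2 + c))) 0 =
      deriv (deriv V) (Real.log (a ^ 2 + c)) * (4 * a ^ 2 / (a ^ 2 + c) ^ 2) +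
        deriv V (Real.log (a ^ 2 + c)) * (2 / (a ^ 2 + c) - 4 * a ^ 2 / (a ^ 2 + c) ^ 2) := by
  have hV' : ContDiff ℝ ∞ (deriv V) := (contDiff_infty_iff_deriv.1 hV).2
  have hs : ∀ t : ℝ, HasDerivAt (fun t : ℝ => (a + t) ^ 2 + c) (2 * (a + t)) t := fun t => by
    simpa using (((hasDerivAt_id t).const_add a).pow 2).add_const c
  have hpos : ∀ᶠ t : ℝ in 𝓝 0, 0 < (a + t) ^ 2 + c := by
    have : ContinuousAt (fun t : ℝ => (a + t) ^ 2 + c) 0 := (hs 0).continuousAt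
    exact this.eventually (lt_mem_nhds (by simpa using h0))
  have e1 : deriv (fun t : ℝ => V (Real.log ((a + t) ^ 2 + c))) =ᶠ[𝓝 0]
      fun t => deriv V (Real.log ((a + t) ^ 2 + c)) * (2 * (a + t) / ((a + t) ^ 2 + c)) := by
    filter_upwards [hpos] with t ht
    exact (((hV.differentiable (by simp)) _).hasDerivAt.comp t ((hs t).log ht.ne')).deriv
  have h3 : HasDerivAt (fun t : ℝ => 2 * (a + t)) 2 0 := by
    simpa using ((hasDerivAt_id (0 : ℝ)).const_add a).const_mul 2
  have h0' : (a + 0) ^ 2 + c ≠ 0 := by simpa using h0.ne'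
  rw [e1.deriv_eq]
  have h4 : HasDerivAt (fun t : ℝ => deriv V (Real.log ((a + t) ^ 2 + c))) _ 0 :=
    ((hV'.differentiable (by simp)) _).hasDerivAt.comp 0 ((hs 0).log h0')
  rw [(h4.fun_mul (h3.fun_div (hs 0) h0')).deriv]
  have := h0.ne'
  simp only [add_zero]
  field_simp
  ring

namespace ToricMetric

variable (h : ToricMetric)

theorem contDiff_U : ContDiff ℝ ∞ h.U := by
  have : ContDiff ℝ ∞ (fun ρ : ℝ => ((Real.exp (ρ / 2) : ℝ) : ℂ)) :=
    Complex.ofRealCLM.contDiff.comp (Real.contDiff_exp.comp (contDiff_id.div_const 2))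
  exact h.smooth_pot.comp this

theorem contDiff_deriv_U : ContDiff ℝ ∞ (deriv h.U) := (contDiff_infty_iff_deriv.1 h.contDiff_U).2

theorem hasDerivAt_U (ρ : ℝ) : HasDerivAt h.U (deriv h.U ρ) ρ :=
  (h.contDiff_U.differentiable (by simp) ρ).hasDerivAt

theorem hasDerivAt_deriv_U (ρ : ℝ) : HasDerivAt (deriv h.U) (deriv (deriv h.U) ρ) ρ :=
  (h.contDiff_deriv_U.differentiable (by simp) ρ).hasDerivAt

theorem continuous_deriv_deriv_U : Continuous (deriv (deriv h.U)) :=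
  (contDiff_infty_iff_deriv.1 h.contDiff_deriv_U).2.continuous

theorem pot_norm (z : ℂ) (hz : z ≠ 0) : h.pot z = h.pot (‖z‖ : ℂ) := by
  have hn : (‖z‖ : ℂ) ≠ 0 := by simpa using hz
  have := h.rot (z / ‖z‖) ‖z‖ (by simp [hz])
  rwa [div_mul_cancel₀ _ hn] at this

theorem pot_eq_U (z : ℂ) (hz : z ≠ 0) : h.pot z = h.U (Real.log (‖z‖ ^ 2)) := by
  have hn : 0 < ‖z‖ := norm_pos_iff.2 hz
  rw [h.pot_norm z hz, U, Real.log_pow]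
  congr 2
  rw [Nat.cast_ofNat, mul_div_cancel_left₀ _ two_ne_zero, Real.exp_log hn]

/-- The Laplacian of a function of `log |z|²`: the first-order terms from the two axes cancel
because the logarithm is harmonic. -/
theorem ddbar_pot (z : ℂ) (hz : z ≠ 0) :
    ddbar h.pot z = deriv (deriv h.U) (Real.log (‖z‖ ^ 2)) / ‖z‖ ^ 2 := by
  have hn : ∀ z : ℂ, ‖z‖ ^ 2 = z.re ^ 2 + z.im ^ 2 := fun z => by
    rw [Complex.sq_norm, Complex.normSq_apply]; ring
  have hpos : 0 < z.re ^ 2 + z.im ^ 2 := by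
    rw [← hn]; exact pow_pos (norm_pos_iff.2 hz) 2
  have hline : ∀ v : ℂ, ∀ᶠ t : ℝ in 𝓝 0, z + t • v ≠ 0 := fun v => by
    have : ContinuousAt (fun t : ℝ => z + t • v) 0 := by fun_prop
    exact this.eventually_ne (by simpa using hz)
  have e1 : (fun t : ℝ => h.pot (z + t • (1 : ℂ))) =ᶠ[𝓝 0]
      fun t : ℝ => h.U (Real.log ((z.re + t) ^ 2 + z.im ^ 2)) := by
    filter_upwards [hline 1] with t ht
    rw [h.pot_eq_U _ ht, hn]; simp
  have e2 : (fun t : ℝ => h.pot (z + t • Complex.I)) =ᶠ[𝓝 0]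
      fun t : ℝ => h.U (Real.log ((z.im + t) ^ 2 + z.re ^ 2)) := by
    filter_upwards [hline Complex.I] with t ht
    rw [h.pot_eq_U _ ht, hn]; simp [add_comm]
  have hq : z.im ^ 2 + z.re ^ 2 = z.re ^ 2 + z.im ^ 2 := add_comm _ _
  rw [ddbar, InnerProductSpace.laplacian_eq_iteratedFDeriv_complexPlane]
  beta_reduce
  rw [iteratedFDeriv_two_line h.smooth_pot, iteratedFDeriv_two_line h.smooth_pot,
    e1.deriv.deriv_eq, e2.deriv.deriv_eq, deriv_deriv_comp_log_sq h.contDiff_U _ _ hpos,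
    deriv_deriv_comp_log_sq h.contDiff_U _ _ (hq ▸ hpos), hn, hq]
  field_simp
  ring

theorem deriv_deriv_U (ρ : ℝ) :
    deriv (deriv h.U) ρ = Real.exp ρ * ddbar h.pot (Real.exp (ρ / 2) : ℂ) := by
  have hz : ((Real.exp (ρ / 2) : ℝ) : ℂ) ≠ 0 := by exact_mod_cast (Real.exp_pos _).ne'
  have e : Real.exp (ρ / 2) ^ 2 = Real.exp ρ := by
    rw [← Real.exp_nat_mul]; congr 1; push_cast; ring
  rw [h.ddbar_pot _ hz, Complex.norm_real, Real.norm_eq_abs, Real.abs_exp, e, Real.log_exp,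
    mul_div_cancel₀ _ (Real.exp_pos ρ).ne']

theorem deriv_deriv_U_pos (ρ : ℝ) : 0 < deriv (deriv h.U) ρ := by
  rw [deriv_deriv_U]
  exact mul_pos (Real.exp_pos ρ) (h.pos_pot _)

theorem strictMono_deriv_U : StrictMono (deriv h.U) :=
  strictMono_of_deriv_pos h.deriv_deriv_U_pos

theorem tendsto_exp_half_atBot :
    Tendsto (fun ρ : ℝ => ((Real.exp (ρ / 2) : ℝ) : ℂ)) atBot (𝓝 0) := by
  have h1 : Tendsto (fun ρ : ℝ => Real.exp (ρ / 2)) atBot (𝓝 0) :=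
    Real.tendsto_exp_atBot.comp (tendsto_id.atBot_div_const two_pos)
  have := (Complex.continuous_ofReal.tendsto 0).comp h1
  rwa [Complex.ofReal_zero] at this

theorem tendsto_U_atBot : Tendsto h.U atBot (𝓝 (h.pot 0)) :=
  (h.smooth_pot.continuous.tendsto 0).comp tendsto_exp_half_atBot

/-- By the chain rule `U' ρ` is half the differential of `pot` at `z = exp (ρ / 2)` applied to `z`
itself, and `z → 0`. -/
theorem tendsto_deriv_U_atBot : Tendsto (deriv h.U) atBot (𝓝 0) := by
  have e : ∀ ρ : ℝ, deriv h.U ρ = fderiv ℝ h.pot (Real.exp (ρ / 2) : ℂ)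
      ((Real.exp (ρ / 2) : ℝ) : ℂ) * (1 / 2) := fun ρ => by
    have h1 : HasDerivAt (fun ρ : ℝ => ((Real.exp (ρ / 2) : ℝ) : ℂ))
        (((Real.exp (ρ / 2) * (1 / 2) : ℝ)) : ℂ) ρ :=
      (((hasDerivAt_id ρ).div_const 2).exp).ofReal_comp
    have h2 := ((h.smooth_pot.differentiable (by simp)) (Real.exp (ρ / 2) : ℂ)).hasFDerivAt
      |>.comp_hasDerivAt ρ h1
    have h3 : HasDerivAt h.U _ ρ := h2
    rw [h3.deriv]
    have : ((Real.exp (ρ / 2) * (1 / 2) : ℝ) : ℂ) =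
        (1 / 2 : ℝ) • ((Real.exp (ρ / 2) : ℝ) : ℂ) := by
      rw [Complex.real_smul, ← Complex.ofReal_mul, mul_comm]
    rw [this, map_smul, smul_eq_mul, mul_comm]
  have hc : Continuous fun z : ℂ => fderiv ℝ h.pot z z * (1 / 2) :=
    ((h.smooth_pot.continuous_fderiv (by simp)).clm_apply continuous_id).mul_const _
  have := (hc.tendsto 0).comp tendsto_exp_half_atBot
  rw [map_zero, zero_mul] at this
  exact this.congr fun ρ => (e ρ).symm

theorem deriv_U_pos (ρ : ℝ) : 0 < deriv h.U ρ :=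
  (h.strictMono_deriv_U.monotone.le_of_tendsto h.tendsto_deriv_U_atBot (ρ - 1)).trans_lt
    (h.strictMono_deriv_U (by linarith))

theorem monotone_U : Monotone h.U :=
  monotone_of_deriv_nonneg (h.contDiff_U.differentiable (by simp)) fun ρ => (h.deriv_U_pos ρ).le

/-- The same metric, with the roles of the charts `z` and `1 / z` exchanged. -/
def swap : ToricMetric where
  pot := h.potInf
  potInf := h.pot
  smooth_pot := h.smooth_potInf
  smooth_potInf := h.smooth_pot
  compat w hw := by
    rw [h.compat _ (inv_ne_zero hw), inv_inv, norm_inv, inv_pow, Real.log_inv]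
    ring
  rot c z hc := by
    rcases eq_or_ne z 0 with rfl | hz
    · simp
    · have hc0 : c ≠ 0 := fun h0 => by simp [h0] at hc
      rw [h.compat _ (mul_ne_zero hc0 hz), h.compat z hz, mul_inv, h.rot _ _ (by simp [hc]),
        norm_mul, hc, one_mul]
  pos_pot := h.pos_potInf
  pos_potInf := h.pos_pot

/-- Exchanging the charts acts by `ρ ↦ -ρ` and `x ↦ 1 - x`. Statements at `ρ → +∞` or `x = 1` reduce
in this way to those at `ρ → -∞` or `x = 0`. -/
theorem swap_U (ρ : ℝ) : h.swap.U ρ = h.U (-ρ) + ρ := by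
  have hz : ((Real.exp (ρ / 2) : ℝ) : ℂ) ≠ 0 := by exact_mod_cast (Real.exp_pos _).ne'
  change h.potInf _ = _
  have e : Real.exp (ρ / 2) ^ 2 = Real.exp ρ := by
    rw [← Real.exp_nat_mul]; congr 1; push_cast; ring
  rw [h.compat _ hz, Complex.norm_real, Real.norm_eq_abs, Real.abs_exp, e, Real.log_exp, U,
    ← Complex.ofReal_inv, ← Real.exp_neg, neg_div]

theorem deriv_swap_U (ρ : ℝ) : deriv h.swap.U ρ = 1 - deriv h.U (-ρ) := by
  have e : h.swap.U = fun ρ => h.U (-ρ) + ρ := funext h.swap_U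
  have h1 : HasDerivAt (fun ρ => h.U (-ρ) + ρ) (deriv h.U (-ρ) * (-1) + 1) ρ :=
    ((h.hasDerivAt_U (-ρ)).comp ρ (hasDerivAt_neg ρ)).add (hasDerivAt_id ρ)
  rw [e, h1.deriv]
  ring

theorem deriv_deriv_swap_U (ρ : ℝ) : deriv (deriv h.swap.U) ρ = deriv (deriv h.U) (-ρ) := by
  have e : deriv h.swap.U = fun ρ => 1 - deriv h.U (-ρ) := funext h.deriv_swap_U
  have h1 : HasDerivAt (fun ρ => 1 - deriv h.U (-ρ)) (-(deriv (deriv h.U) (-ρ) * (-1))) ρ :=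
    ((h.hasDerivAt_deriv_U (-ρ)).comp ρ (hasDerivAt_neg ρ)).const_sub 1
  rw [e, h1.deriv]
  ring

theorem deriv_U_eq_swap (ρ : ℝ) : deriv h.U ρ = 1 - deriv h.swap.U (-ρ) := by
  rw [deriv_swap_U, neg_neg]
  ring

theorem deriv_U_lt_one (ρ : ℝ) : deriv h.U ρ < 1 := by
  have := h.swap.deriv_U_pos (-ρ)
  rw [deriv_U_eq_swap]
  linarith

theorem deriv_U_mem (ρ : ℝ) : deriv h.U ρ ∈ Ioo (0 : ℝ) 1 := ⟨h.deriv_U_pos ρ, h.deriv_U_lt_one ρ⟩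

theorem tendsto_deriv_U_atTop : Tendsto (deriv h.U) atTop (𝓝 1) := by
  have := (h.swap.tendsto_deriv_U_atBot.comp tendsto_neg_atTop_atBot).const_sub 1
  rw [sub_zero] at this
  exact this.congr fun ρ => (h.deriv_U_eq_swap ρ).symm

theorem exists_deriv_U_eq {x : ℝ} (hx : x ∈ Ioo (0 : ℝ) 1) : ∃ ρ, deriv h.U ρ = x := by
  have h1 := (h.tendsto_deriv_U_atBot.eventually (gt_mem_nhds hx.1)).exists
  have h2 := (h.tendsto_deriv_U_atTop.eventually (lt_mem_nhds hx.2)).exists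
  exact mem_range_of_exists_le_of_exists_ge h.contDiff_deriv_U.continuous
    (h1.imp fun _ => le_of_lt) (h2.imp fun _ => le_of_lt)

/-- The inverse of the moment map `ρ ↦ U' ρ`. -/
noncomputable def rho (x : ℝ) : ℝ := Function.invFun (deriv h.U) x

theorem rho_deriv_U (ρ : ℝ) : h.rho (deriv h.U ρ) = ρ :=
  Function.leftInverse_invFun h.strictMono_deriv_U.injective ρ

theorem deriv_U_rho {x : ℝ} (hx : x ∈ Ioo (0 : ℝ) 1) : deriv h.U (h.rho x) = x :=
  Function.invFun_eq (h.exists_deriv_U_eq hx)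

theorem hasDerivAt_rho {x : ℝ} (hx : x ∈ Ioo (0 : ℝ) 1) :
    HasDerivAt h.rho (deriv (deriv h.U) (h.rho x))⁻¹ x := by
  have h1 : HasStrictDerivAt (deriv h.U) (deriv (deriv h.U) (h.rho x)) (h.rho x) :=
    h.contDiff_deriv_U.contDiffAt.hasStrictDerivAt (by simp)
  have := (h1.to_local_left_inverse (h.deriv_deriv_U_pos _).ne'
    (Eventually.of_forall h.rho_deriv_U)).hasDerivAt
  rwa [h.deriv_U_rho hx] at this

theorem rho_lt {x ρ : ℝ} (hx : x ∈ Ioo (0 : ℝ) 1) (hρ : x < deriv h.U ρ) : h.rho x < ρ :=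
  h.strictMono_deriv_U.lt_iff_lt.1 (by rwa [h.deriv_U_rho hx])

theorem lt_rho {x ρ : ℝ} (hx : x ∈ Ioo (0 : ℝ) 1) (hρ : deriv h.U ρ < x) : ρ < h.rho x :=
  h.strictMono_deriv_U.lt_iff_lt.1 (by rwa [h.deriv_U_rho hx])

theorem tendsto_rho_zero : Tendsto h.rho (𝓝[Ioo 0 1] 0) atBot := by
  refine tendsto_atBot.2 fun b => ?_
  filter_upwards [self_mem_nhdsWithin,
    mem_nhdsWithin_of_mem_nhds (gt_mem_nhds (h.deriv_U_pos b))] with x hx hxb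
  exact (h.rho_lt hx hxb).le

theorem tendsto_rho_one : Tendsto h.rho (𝓝[Ioo 0 1] 1) atTop := by
  refine tendsto_atTop.2 fun b => ?_
  filter_upwards [self_mem_nhdsWithin,
    mem_nhdsWithin_of_mem_nhds (lt_mem_nhds (h.deriv_U_lt_one b))] with x hx hxb
  exact (h.lt_rho hx hxb).le

end ToricMetric

/-! ### The symplectic potential, its divergence and its Hessian ratio. -/

namespace ToricMetric

variable (h : ToricMetric)

theorem swap_G (x : ℝ) : h.swap.G x = h.G (1 - x) := by
  unfold G
  rw [← (Equiv.neg ℝ).iSup_comp (g := fun ρ => (1 - x) * ρ - h.U ρ)]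
  congr 1
  funext ρ
  rw [swap_U, Equiv.neg_apply]
  ring

theorem G_zero : h.G 0 = -h.pot 0 := by
  have hlub : IsLUB (range fun ρ => -h.U ρ) (-h.pot 0) :=
    isLUB_of_tendsto_atBot (fun _ _ hab => neg_le_neg (h.monotone_U hab)) h.tendsto_U_atBot.neg
  simpa [G, iSup] using hlub.csSup_eq (range_nonempty _)

theorem G_one : h.G 1 = -h.potInf 0 := by
  have := h.swap.G_zero
  rwa [swap_G, sub_zero] at this

theorem mul_sub_U_le {x : ℝ} (hx : x ∈ Ioo (0 : ℝ) 1) (ρ : ℝ) :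
    x * ρ - h.U ρ ≤ x * h.rho x - h.U (h.rho x) := by
  have hd : ∀ ρ, HasDerivAt (fun ρ => x * ρ - h.U ρ) (x - deriv h.U ρ) ρ := fun ρ => by
    exact (((hasDerivAt_id ρ).const_mul x).sub (h.hasDerivAt_U ρ)).congr_deriv (by simp)
  have hc : Continuous fun ρ => x * ρ - h.U ρ :=
    continuous_iff_continuousAt.2 fun ρ => (hd ρ).continuousAt
  rcases le_total ρ (h.rho x) with hle | hle
  · refine monotoneOn_of_deriv_nonneg (convex_Iic (h.rho x)) hc.continuousOn
      (fun y _ => (hd y).differentiableAt.differentiableWithinAt) (fun y hy => ?_) hle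
      (mem_Iic.2 le_rfl) hle
    rw [(hd y).deriv, sub_nonneg]
    exact (h.strictMono_deriv_U.monotone (mem_Iic.1 (interior_subset hy))).trans_eq (h.deriv_U_rho hx)
  · refine antitoneOn_of_deriv_nonpos (convex_Ici (h.rho x)) hc.continuousOn
      (fun y _ => (hd y).differentiableAt.differentiableWithinAt) (fun y hy => ?_)
      (mem_Ici.2 le_rfl) hle hle
    rw [(hd y).deriv, sub_nonpos]
    exact (h.deriv_U_rho hx).symm.trans_le (h.strictMono_deriv_U.monotone (mem_Ici.1 (interior_subset hy)))

theorem G_eq {x : ℝ} (hx : x ∈ Ioo (0 : ℝ) 1) : h.G x = x * h.rho x - h.U (h.rho x) := by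
  have : IsGreatest (range fun ρ => x * ρ - h.U ρ) (x * h.rho x - h.U (h.rho x)) :=
    ⟨⟨h.rho x, rfl⟩, by rintro _ ⟨ρ, rfl⟩; exact h.mul_sub_U_le hx ρ⟩
  exact this.csSup_eq

theorem hasDerivAt_U_rho {x : ℝ} (hx : x ∈ Ioo (0 : ℝ) 1) :
    HasDerivAt (fun x => h.U (h.rho x)) (x * (deriv (deriv h.U) (h.rho x))⁻¹) x := by
  have := (h.hasDerivAt_U (h.rho x)).comp x (h.hasDerivAt_rho hx)
  rwa [h.deriv_U_rho hx] at this

/-- Legendre duality: in the derivative of `x * rho x - U (rho x)` the terms containing `rho'`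
cancel because `U' (rho x) = x`. -/
theorem hasDerivAt_G {x : ℝ} (hx : x ∈ Ioo (0 : ℝ) 1) : HasDerivAt h.G (h.rho x) x := by
  have h1 := ((hasDerivAt_id x).mul (h.hasDerivAt_rho hx)).sub (h.hasDerivAt_U_rho hx)
  refine (h1.congr_of_eventuallyEq ?_).congr_deriv (by simp)
  filter_upwards [isOpen_Ioo.mem_nhds hx] with y hy
  exact h.G_eq hy

theorem deriv_deriv_G {x : ℝ} (hx : x ∈ Ioo (0 : ℝ) 1) :
    deriv (deriv h.G) x = (deriv (deriv h.U) (h.rho x))⁻¹ := by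
  have e : deriv h.G =ᶠ[𝓝 x] h.rho := by
    filter_upwards [isOpen_Ioo.mem_nhds hx] with y hy
    exact (h.hasDerivAt_G hy).deriv
  rw [e.deriv_eq, (h.hasDerivAt_rho hx).deriv]

/-- The Bregman divergence of the symplectic potential. -/
noncomputable def divG (α x : ℝ) : ℝ := h.U (h.rho x) + h.G α - α * h.rho x

theorem hasDerivAt_divG (α : ℝ) {x : ℝ} (hx : x ∈ Ioo (0 : ℝ) 1) :
    HasDerivAt (h.divG α) ((x - α) * (deriv (deriv h.U) (h.rho x))⁻¹) x :=
  (((h.hasDerivAt_U_rho hx).add_const (h.G α)).sub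
    ((h.hasDerivAt_rho hx).const_mul α)).congr_deriv (by ring)

theorem tendsto_divG {α : ℝ} (hα : α ∈ Icc (0 : ℝ) 1) :
    Tendsto (h.divG α) (𝓝[Ioo 0 1] α) (𝓝 0) := by
  rcases hα.1.eq_or_lt with rfl | hpos
  · have := (h.tendsto_U_atBot.comp h.tendsto_rho_zero).add_const (h.G 0)
    rw [G_zero, add_neg_cancel] at this
    refine this.congr fun x => ?_
    simp [divG, G_zero]
  rcases hα.2.eq_or_lt with rfl | hlt
  -- At `α = 1` the divergence contains `U ρ - ρ`, which is the potential `swap.U (-ρ)` in the other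
  -- chart and tends to `potInf 0`.
  · have := (h.swap.tendsto_U_atBot.comp
      (tendsto_neg_atTop_atBot.comp h.tendsto_rho_one)).add_const (h.G 1)
    rw [G_one, show h.swap.pot 0 = h.potInf 0 from rfl, add_neg_cancel] at this
    refine this.congr fun x => ?_
    simp only [divG, G_one, Function.comp_apply, swap_U, neg_neg]
    ring
  · have h0 : h.divG α α = 0 := by rw [divG, h.G_eq ⟨hpos, hlt⟩]; ring
    have := (h.hasDerivAt_divG α ⟨hpos, hlt⟩).continuousAt.tendsto.mono_left
      (nhdsWithin_le_nhds (s := Ioo 0 1))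
    rwa [h0] at this

/-- The ratio `G'' / GP''` as a function of `ρ`. -/
noncomputable def hessRatio (ρ : ℝ) : ℝ :=
  deriv h.U ρ * (1 - deriv h.U ρ) / deriv (deriv h.U) ρ

theorem swap_hessRatio (ρ : ℝ) : h.swap.hessRatio (-ρ) = h.hessRatio ρ := by
  simp only [hessRatio, deriv_swap_U, deriv_deriv_swap_U, neg_neg]
  ring

theorem continuous_hessRatio : Continuous h.hessRatio := by
  have := h.contDiff_deriv_U.continuous
  exact (this.mul (continuous_const.sub this)).div h.continuous_deriv_deriv_U
    fun ρ => (h.deriv_deriv_U_pos ρ).ne'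

theorem continuous_ddbar_pot : Continuous (ddbar h.pot) := by
  have e : ddbar h.pot = fun z => 1 / 4 * (fderiv ℝ (fderiv ℝ h.pot) z 1 1 +
      fderiv ℝ (fderiv ℝ h.pot) z Complex.I Complex.I) := by
    funext z
    rw [ddbar, InnerProductSpace.laplacian_eq_iteratedFDeriv_complexPlane]
    simp [iteratedFDeriv_two_apply]
  have h1 : ContDiff ℝ ∞ (fderiv ℝ h.pot) := h.smooth_pot.fderiv_right (by simp)
  have h2 : Continuous (fderiv ℝ (fderiv ℝ h.pot)) := h1.continuous_fderiv (by simp)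
  rw [e]
  fun_prop

/-- As `z → 0` both `U''` and, by L'Hôpital, `U'` are asymptotic to `ddbar h.pot 0 * exp ρ`, with a
positive coefficient, while `1 - U' → 1`. -/
theorem tendsto_hessRatio_atBot : Tendsto h.hessRatio atBot (𝓝 1) := by
  have hA : Tendsto (fun ρ : ℝ => ddbar h.pot (Real.exp (ρ / 2) : ℂ)) atBot
      (𝓝 (ddbar h.pot 0)) :=
    (h.continuous_ddbar_pot.tendsto 0).comp tendsto_exp_half_atBot
  have h1 : Tendsto (fun ρ => deriv h.U ρ / Real.exp ρ) atBot (𝓝 (ddbar h.pot 0)) := by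
    refine HasDerivAt.lhopital_zero_atBot (Eventually.of_forall h.hasDerivAt_deriv_U)
      (Eventually.of_forall Real.hasDerivAt_exp) (Eventually.of_forall fun ρ =>
        (Real.exp_pos ρ).ne') h.tendsto_deriv_U_atBot Real.tendsto_exp_atBot (hA.congr fun ρ => ?_)
    rw [deriv_deriv_U, mul_div_cancel_left₀ _ (Real.exp_pos ρ).ne']
  have h2 := (h1.mul (h.tendsto_deriv_U_atBot.const_sub 1)).div hA (h.pos_pot 0).ne'
  rw [sub_zero, mul_one, div_self (h.pos_pot 0).ne'] at h2
  refine h2.congr fun ρ => ?_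
  have := (h.pos_pot (Real.exp (ρ / 2) : ℂ)).ne'
  have := (Real.exp_pos ρ).ne'
  simp only [hessRatio, deriv_deriv_U, Pi.div_apply]
  field_simp

theorem tendsto_hessRatio_atTop : Tendsto h.hessRatio atTop (𝓝 1) :=
  (h.swap.tendsto_hessRatio_atBot.comp tendsto_neg_atTop_atBot).congr h.swap_hessRatio

/-- The ratio `G'' / GP''` on `(0, 1)`, with its boundary values. -/
noncomputable def Gam (x : ℝ) : ℝ :=
  open Classical in if x ∈ Ioo (0 : ℝ) 1 then h.hessRatio (h.rho x) else 1

theorem Gam_of_mem {x : ℝ} (hx : x ∈ Ioo (0 : ℝ) 1) : h.Gam x = h.hessRatio (h.rho x) :=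
  if_pos hx

theorem Gam_zero : h.Gam 0 = 1 := if_neg (by simp)

theorem Gam_one : h.Gam 1 = 1 := if_neg (by simp)

theorem continuousOn_Gam : ContinuousOn h.Gam (Icc 0 1) := by
  have hev : ∀ x, ∀ᶠ y in 𝓝[Ioo 0 1] x, h.hessRatio (h.rho y) = h.Gam y := fun x => by
    filter_upwards [self_mem_nhdsWithin] with y hy using (h.Gam_of_mem hy).symm
  intro x hx
  rcases hx.1.eq_or_lt with rfl | hpos
  · have h1 : Tendsto h.Gam (𝓝[Ioo 0 1] 0) (𝓝 (h.Gam 0)) := by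
      rw [Gam_zero]
      exact (h.tendsto_hessRatio_atBot.comp h.tendsto_rho_zero).congr' (hev 0)
    rw [nhdsWithin_Ioo_eq_nhdsGT zero_lt_one] at h1
    exact (continuousWithinAt_Ioi_iff_Ici.1 h1).mono Icc_subset_Ici_self
  rcases hx.2.eq_or_lt with rfl | hlt
  · have h1 : Tendsto h.Gam (𝓝[Ioo 0 1] 1) (𝓝 (h.Gam 1)) := by
      rw [Gam_one]
      exact (h.tendsto_hessRatio_atTop.comp h.tendsto_rho_one).congr' (hev 1)
    rw [nhdsWithin_Ioo_eq_nhdsLT zero_lt_one] at h1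
    exact (continuousWithinAt_Iio_iff_Iic.1 h1).mono Icc_subset_Iic_self
  · have hx' : x ∈ Ioo (0 : ℝ) 1 := ⟨hpos, hlt⟩
    have h1 : ContinuousAt (fun y => h.hessRatio (h.rho y)) x :=
      h.continuous_hessRatio.continuousAt.comp (h.hasDerivAt_rho hx').continuousAt
    have h2 := hev x
    rw [isOpen_Ioo.nhdsWithin_eq hx'] at h2
    exact (h1.congr h2).continuousWithinAt

theorem isDivergence_divG {α : ℝ} (hα : α ∈ Icc (0 : ℝ) 1) :
    IsDivergence (fun x => h.Gam x / (x * (1 - x))) α (h.divG α) where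
  hasDerivAt x hx := by
    refine (h.hasDerivAt_divG α hx).congr_deriv ?_
    have h1 : x ≠ 0 := hx.1.ne'
    have h2 : 1 - x ≠ 0 := (sub_pos.2 hx.2).ne'
    have h3 := (h.deriv_deriv_U_pos (h.rho x)).ne'
    simp only [h.Gam_of_mem hx, hessRatio, h.deriv_U_rho hx]
    field_simp
  tendsto := h.tendsto_divG hα

/-! ### Norming constants as Laplace integrals over the polytope. -/

/-- Polar coordinates followed by the change of variable `x = U' (2 log r)`, whose Jacobian absorbs
the curvature density. -/
theorem normSq_eq (N : ℕ) (α : ℝ) :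
    h.normSq N α =
      2 * Real.pi * ∫ x in Ioo (0 : ℝ) 1, Real.exp (N * (α * h.rho x - h.U (h.rho x))) := by
  set f : ℝ → ℝ := fun r => r ^ (2 * (N * α)) * Real.exp (-(N * h.U (Real.log (r ^ 2)))) *
    (2 * (deriv (deriv h.U) (Real.log (r ^ 2)) / r ^ 2)) with hf
  have e1 : h.normSq N α = ∫ z : ℂ, f ‖z‖ := by
    refine integral_congr_ae ?_
    have : ∀ᵐ z : ℂ, z ≠ 0 := by simp [ae_iff]
    filter_upwards [this] with z hz
    rw [h.ddbar_pot z hz, h.pot_eq_U z hz]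
  have hφ : ∀ r ∈ Ioi (0 : ℝ), HasDerivAt (fun r => deriv h.U (2 * Real.log r))
      (deriv (deriv h.U) (2 * Real.log r) * (2 * r⁻¹)) r := fun r hr =>
    (h.hasDerivAt_deriv_U _).comp r ((Real.hasDerivAt_log (ne_of_gt hr)).const_mul 2)
  have hinj : InjOn (fun r => deriv h.U (2 * Real.log r)) (Ioi 0) := fun a ha b hb hab => by
    have := h.strictMono_deriv_U.injective hab
    exact Real.log_injOn_pos ha hb (by linarith)
  have himg : (fun r => deriv h.U (2 * Real.log r)) '' Ioi 0 = Ioo 0 1 := by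
    ext x
    constructor
    · rintro ⟨r, -, rfl⟩
      exact h.deriv_U_mem _
    · intro hx
      refine ⟨Real.exp (h.rho x / 2), Real.exp_pos _, ?_⟩
      simp only [Real.log_exp]
      rw [mul_div_cancel₀ _ two_ne_zero, h.deriv_U_rho hx]
  have e2 := integral_image_eq_integral_abs_deriv_smul measurableSet_Ioi
    (fun r hr => (hφ r hr).hasDerivWithinAt) hinj
    (fun x => Real.exp (N * (α * h.rho x - h.U (h.rho x))))
  rw [himg] at e2
  rw [e1, integral_fun_norm_addHaar volume f, e2, Complex.finrank_real_complex]
  -- The polar formula contributes the real dimension `2` times the area of the unit disc, which is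
  -- the factor `2π`.
  have hball : volume.real (Metric.ball (0 : ℂ) 1) = Real.pi := by
    simp [measureReal_def]
  rw [hball, nsmul_eq_mul, smul_eq_mul, Nat.cast_ofNat, mul_assoc]
  congr 2
  refine setIntegral_congr_fun measurableSet_Ioi fun r hr => ?_
  have hr : 0 < r := hr
  have hK := h.deriv_deriv_U_pos (2 * Real.log r)
  have hlog : Real.log (r ^ 2) = 2 * Real.log r := by simp
  simp only [hf, smul_eq_mul, h.rho_deriv_U, hlog]
  rw [abs_of_pos (by positivity), Real.rpow_def_of_pos hr, ← Real.exp_add]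
  have e3 : Real.log r * (2 * (N * α)) + -(N * h.U (2 * Real.log r)) =
      N * (α * (2 * Real.log r) - h.U (2 * Real.log r)) := by ring
  rw [e3]
  field_simp
  ring

/-- The normalizing constant `G` is left free so that the canonical metric can be normalized
directly by `GP`. -/
theorem normSq_mul_exp_of_eqOn {D : ℝ → ℝ} {α G : ℝ}
    (hD : ∀ x ∈ Ioo (0 : ℝ) 1, D x = h.U (h.rho x) + G - α * h.rho x) (N : ℕ) :
    h.normSq N α * Real.exp (-(N * G)) = 2 * Real.pi * laplaceInt D N := by
  rw [normSq_eq, mul_assoc, ← integral_mul_const, laplaceInt]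
  congr 1
  refine setIntegral_congr_fun measurableSet_Ioo fun x hx => ?_
  rw [← Real.exp_add, hD x hx]
  congr 1
  ring

end ToricMetric

theorem divP_eq_canonical (α : ℝ) {x : ℝ} (hx : x ∈ Ioo (0 : ℝ) 1) :
    divP α x = canonical.U (canonical.rho x) + GP α - α * canonical.rho x := by
  set ρ := canonical.rho x with hρ
  have hS : 0 < 1 + Real.exp ρ := by positivity
  have hU : HasDerivAt canonical.U (Real.exp ρ / (1 + Real.exp ρ)) ρ := by
    rw [show canonical.U = fun ρ => Real.log (1 + Real.exp ρ) from funext canonical_U]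
    exact ((Real.hasDerivAt_exp ρ).const_add 1).log hS.ne'
  have hx1 : x = Real.exp ρ / (1 + Real.exp ρ) := by
    rw [← hU.deriv, hρ, canonical.deriv_U_rho hx]
  have hx2 : 1 - x = (1 + Real.exp ρ)⁻¹ := by rw [hx1]; field_simp; ring
  have l1 : Real.log x = ρ - Real.log (1 + Real.exp ρ) := by
    rw [hx1, Real.log_div (Real.exp_pos ρ).ne' hS.ne', Real.log_exp]
  rw [divP, l1, hx2, Real.log_inv, canonical_U]
  ring

theorem q_eq (h : ToricMetric) (N : ℕ) (α : ℝ) :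
    q h N α = laplaceInt (h.divG α) N / laplaceInt (divP α) N := by
  rw [q, h.normSq_mul_exp_of_eqOn (D := h.divG α) (fun _ _ => rfl),
    canonical.normSq_mul_exp_of_eqOn (D := divP α) (fun _ hx => divP_eq_canonical α hx),
    mul_div_mul_left _ _ (by positivity)]

theorem deriv_deriv_GP {x : ℝ} (hx : x ∈ Ioo (0 : ℝ) 1) :
    deriv (deriv GP) x = 1 / (x * (1 - x)) := by
  have h1 : ∀ y ∈ Ioo (0 : ℝ) 1, HasDerivAt GP (Real.log y - Real.log (1 - y)) y := by
    intro y hy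
    have h0 : y ≠ 0 := hy.1.ne'
    have h1 : 1 - y ≠ 0 := (sub_pos.2 hy.2).ne'
    have h2 : HasDerivAt (fun y : ℝ => 1 - y) (-1) y := (hasDerivAt_id y).const_sub 1
    refine (((hasDerivAt_id y).mul (Real.hasDerivAt_log h0)).add
      (h2.mul (h2.log h1))).congr_deriv ?_
    simp only [id]
    field_simp
    ring
  have e : deriv GP =ᶠ[𝓝 x] fun y => Real.log y - Real.log (1 - y) := by
    filter_upwards [isOpen_Ioo.mem_nhds hx] with y hy using (h1 y hy).deriv
  have h0 : x ≠ 0 := hx.1.ne'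
  have h3 : 1 - x ≠ 0 := (sub_pos.2 hx.2).ne'
  have h2 : HasDerivAt (fun y : ℝ => 1 - y) (-1) x := (hasDerivAt_id x).const_sub 1
  rw [e.deriv_eq, ((Real.hasDerivAt_log h0).fun_sub (h2.log h3)).deriv]
  field_simp
  ring

/-! ### Bounds on the Hessian ratio uniform in time. -/

namespace ToricMetric

variable (h : ToricMetric)

theorem deriv_deriv_GP_div {x : ℝ} (hx : x ∈ Ioo (0 : ℝ) 1) :
    deriv (deriv GP) x / deriv (deriv h.G) x = 1 / h.Gam x := by
  rw [deriv_deriv_GP hx, h.deriv_deriv_G hx, h.Gam_of_mem hx, hessRatio, h.deriv_U_rho hx]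
  field_simp

/-- Integration of `U'' = exp ρ * ddbar h.pot` from `-∞`, where `U'` vanishes. -/
theorem mul_exp_le_deriv_U {m R : ℝ}
    (hm : ∀ ρ ≤ R, m ≤ ddbar h.pot (Real.exp (ρ / 2) : ℂ)) {ρ : ℝ} (hρ : ρ ≤ R) :
    m * Real.exp ρ ≤ deriv h.U ρ := by
  have hd : ∀ ρ, HasDerivAt (fun ρ => deriv h.U ρ - m * Real.exp ρ)
      (deriv (deriv h.U) ρ - m * Real.exp ρ) ρ := fun ρ =>
    (h.hasDerivAt_deriv_U ρ).sub ((Real.hasDerivAt_exp ρ).const_mul m)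
  have hmono : MonotoneOn (fun ρ => deriv h.U ρ - m * Real.exp ρ) (Iic R) := by
    refine monotoneOn_of_deriv_nonneg (convex_Iic R)
      (fun y _ => (hd y).continuousAt.continuousWithinAt)
      (fun y _ => (hd y).differentiableAt.differentiableWithinAt) fun y hy => ?_
    rw [(hd y).deriv, deriv_deriv_U]
    nlinarith [hm y (mem_Iic.1 (interior_subset hy)), Real.exp_pos y]
  have hlim : Tendsto (fun ρ => deriv h.U ρ - m * Real.exp ρ) atBot (𝓝 0) := by
    simpa using h.tendsto_deriv_U_atBot.sub (Real.tendsto_exp_atBot.const_mul m)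
  have := le_of_tendsto hlim ((eventually_le_atBot ρ).mono fun y hy =>
    hmono (mem_Iic.2 (hy.trans hρ)) hρ hy)
  linarith

theorem deriv_U_le_mul_exp {M R : ℝ}
    (hM : ∀ ρ ≤ R, ddbar h.pot (Real.exp (ρ / 2) : ℂ) ≤ M) {ρ : ℝ} (hρ : ρ ≤ R) :
    deriv h.U ρ ≤ M * Real.exp ρ := by
  have hd : ∀ ρ, HasDerivAt (fun ρ => M * Real.exp ρ - deriv h.U ρ)
      (M * Real.exp ρ - deriv (deriv h.U) ρ) ρ := fun ρ =>
    ((Real.hasDerivAt_exp ρ).const_mul M).sub (h.hasDerivAt_deriv_U ρ)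
  have hmono : MonotoneOn (fun ρ => M * Real.exp ρ - deriv h.U ρ) (Iic R) := by
    refine monotoneOn_of_deriv_nonneg (convex_Iic R)
      (fun y _ => (hd y).continuousAt.continuousWithinAt)
      (fun y _ => (hd y).differentiableAt.differentiableWithinAt) fun y hy => ?_
    rw [(hd y).deriv, deriv_deriv_U]
    nlinarith [hM y (mem_Iic.1 (interior_subset hy)), Real.exp_pos y]
  have hlim : Tendsto (fun ρ => M * Real.exp ρ - deriv h.U ρ) atBot (𝓝 0) := by
    simpa using (Real.tendsto_exp_atBot.const_mul M).sub h.tendsto_deriv_U_atBot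
  have := le_of_tendsto hlim ((eventually_le_atBot ρ).mono fun y hy =>
    hmono (mem_Iic.2 (hy.trans hρ)) hρ hy)
  linarith

theorem hessRatio_bounds_of_nonpos {m M : ℝ} (hm : 0 < m)
    (h1 : ∀ z : ℂ, ‖z‖ ≤ 1 → m ≤ ddbar h.pot z ∧ ddbar h.pot z ≤ M)
    (h2 : ∀ z : ℂ, ‖z‖ ≤ 1 → m ≤ ddbar h.potInf z) {ρ : ℝ} (hρ : ρ ≤ 0) :
    m ^ 2 / M ≤ h.hessRatio ρ ∧ h.hessRatio ρ ≤ M / m := by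
  have hn : ∀ ρ : ℝ, ρ ≤ 0 → ‖((Real.exp (ρ / 2) : ℝ) : ℂ)‖ ≤ 1 := fun ρ hρ => by
    rw [Complex.norm_real, Real.norm_eq_abs, Real.abs_exp, Real.exp_le_one_iff]
    linarith
  have a1 := h.mul_exp_le_deriv_U (fun ρ hρ => (h1 _ (hn ρ hρ)).1) hρ
  have a2 := h.deriv_U_le_mul_exp (fun ρ hρ => (h1 _ (hn ρ hρ)).2) hρ
  -- In the other chart at `ρ = 0` this reads `m ≤ 1 - U' 0`, which keeps `1 - U' ρ` away from zero
  -- for all `ρ ≤ 0`.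
  have a3 := h.swap.mul_exp_le_deriv_U (fun ρ hρ => h2 _ (hn ρ hρ)) (le_refl (0 : ℝ))
  rw [Real.exp_zero, mul_one, deriv_swap_U, neg_zero] at a3
  have a4 : deriv h.U ρ ≤ deriv h.U 0 := h.strictMono_deriv_U.monotone hρ
  have a5 := h.deriv_U_pos ρ
  obtain ⟨b1, b2⟩ := h1 _ (hn ρ hρ)
  have hE := Real.exp_pos ρ
  have hM : 0 < M := hm.trans_le (b1.trans b2)
  rw [hessRatio, deriv_deriv_U]
  set A := ddbar h.pot (Real.exp (ρ / 2) : ℂ)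
  have hA : 0 < A := hm.trans_le b1
  constructor
  · calc m ^ 2 / M = m * Real.exp ρ * m / (Real.exp ρ * M) := by field_simp
      _ ≤ deriv h.U ρ * (1 - deriv h.U ρ) / (Real.exp ρ * A) := by
        refine div_le_div₀ (mul_nonneg a5.le (by linarith))
          (mul_le_mul a1 (by linarith) hm.le a5.le) (by positivity) (by gcongr)
  · calc deriv h.U ρ * (1 - deriv h.U ρ) / (Real.exp ρ * A)
        ≤ M * Real.exp ρ * 1 / (Real.exp ρ * m) := by
          refine div_le_div₀ (by positivity)
            (mul_le_mul a2 (by linarith) (by linarith) (by positivity)) (by positivity) (by gcongr)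
      _ = M / m := by field_simp

/-- The two closed unit discs cover `ℂP¹`; the sign of `rho x` decides which chart is used. -/
theorem Gam_bounds {m M : ℝ} (hm : 0 < m)
    (h1 : ∀ z : ℂ, ‖z‖ ≤ 1 → m ≤ ddbar h.pot z ∧ ddbar h.pot z ≤ M)
    (h2 : ∀ z : ℂ, ‖z‖ ≤ 1 → m ≤ ddbar h.potInf z ∧ ddbar h.potInf z ≤ M) {x : ℝ}
    (hx : x ∈ Ioo (0 : ℝ) 1) : m ^ 2 / M ≤ h.Gam x ∧ h.Gam x ≤ M / m := by
  rw [h.Gam_of_mem hx]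
  rcases le_total (h.rho x) 0 with hle | hle
  · exact h.hessRatio_bounds_of_nonpos hm h1 (fun z hz => (h2 z hz).1) hle
  · rw [← swap_hessRatio]
    exact h.swap.hessRatio_bounds_of_nonpos hm h2 (fun z hz => (h1 z hz).1) (by linarith)

end ToricMetric

/-- The slab contains the whole `ℂ` direction, so its derivative within the slab restricts to the
ordinary spatial derivative, including at the end times `0` and `1`. -/
theorem contDiffOn_fderiv_snd {F : ℝ × ℂ → ℝ} (hF : ContDiffOn ℝ ∞ F (Icc 0 1 ×ˢ univ)) (v : ℂ) :
    ContDiffOn ℝ ∞ (fun p : ℝ × ℂ => fderiv ℝ (fun y => F (p.1, y)) p.2 v) (Icc 0 1 ×ˢ univ) := by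
  set S : Set (ℝ × ℂ) := Icc 0 1 ×ˢ univ
  have hS : UniqueDiffOn ℝ S := (uniqueDiffOn_Icc zero_lt_one).prod uniqueDiffOn_univ
  have h1 : ContDiffOn ℝ ∞ (fun p => fderivWithin ℝ F S p ((0 : ℝ), v)) S :=
    (hF.fderivWithin hS (by simp)).clm_apply contDiffOn_const
  refine h1.congr fun p hp => ?_
  have h2 := (hF.differentiableOn (by simp) p hp).hasFDerivWithinAt
  have h3 : HasFDerivWithinAt (fun y : ℂ => (p.1, y)) (ContinuousLinearMap.inr ℝ ℝ ℂ) univ p.2 :=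
    (hasFDerivAt_prodMk_right p.1 p.2).hasFDerivWithinAt
  have hmaps : MapsTo (fun y : ℂ => (p.1, y)) univ S := fun y _ => ⟨hp.1, mem_univ y⟩
  have h4 := (h2.comp p.2 h3 hmaps).hasFDerivAt_of_univ
  have h5 : HasFDerivAt (fun y => F (p.1, y)) _ p.2 := h4
  rw [h5.fderiv]
  simp

theorem continuousOn_ddbar_snd {F : ℝ × ℂ → ℝ} (hF : ContDiffOn ℝ ∞ F (Icc 0 1 ×ˢ univ)) :
    ContinuousOn (fun p : ℝ × ℂ => ddbar (fun y => F (p.1, y)) p.2) (Icc 0 1 ×ˢ univ) := by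
  have h1 := contDiffOn_fderiv_snd (contDiffOn_fderiv_snd hF 1) 1
  have h2 := contDiffOn_fderiv_snd (contDiffOn_fderiv_snd hF Complex.I) Complex.I
  refine ((continuousOn_const (c := (1 / 4 : ℝ))).mul
    (h1.continuousOn.add h2.continuousOn)).congr fun p hp => ?_
  have hsm : ContDiff ℝ ∞ fun y => F (p.1, y) :=
    contDiffOn_univ.1 (hF.comp (by fun_prop) fun y _ => ⟨hp.1, mem_univ y⟩)
  have hd : DifferentiableAt ℝ (fderiv ℝ fun y => F (p.1, y)) p.2 :=
    (hsm.fderiv_right (m := ∞) (by simp)).differentiable (by simp) p.2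
  rw [ddbar, InnerProductSpace.laplacian_eq_iteratedFDeriv_complexPlane]
  simp only [iteratedFDeriv_two_apply]
  have hv : ∀ v : ℂ, fderiv ℝ (fun z => fderiv ℝ (fun y => F (p.1, y)) z v) p.2 v =
      fderiv ℝ (fderiv ℝ fun y => F (p.1, y)) p.2 v v := fun v => by
    rw [fderiv_clm_apply hd (differentiableAt_const _)]
    simp
  simp [hv]

theorem exists_ddbar_bounds {u : ℝ → ℂ → ℝ}
    (hu : ContDiffOn ℝ ∞ (fun p : ℝ × ℂ => u p.1 p.2) (Icc 0 1 ×ˢ univ))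
    (hpos : ∀ t z, 0 < ddbar (u t) z) :
    ∃ m > 0, ∃ M, ∀ t ∈ Icc (0 : ℝ) 1, ∀ z : ℂ, ‖z‖ ≤ 1 →
      m ≤ ddbar (u t) z ∧ ddbar (u t) z ≤ M := by
  have hK : IsCompact (Icc (0 : ℝ) 1 ×ˢ Metric.closedBall (0 : ℂ) 1) :=
    isCompact_Icc.prod (isCompact_closedBall 0 1)
  have hne : (Icc (0 : ℝ) 1 ×ˢ Metric.closedBall (0 : ℂ) 1).Nonempty := ⟨(0, 0), by simp⟩
  have hc : ContinuousOn (fun p : ℝ × ℂ => ddbar (u p.1) p.2)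
      (Icc (0 : ℝ) 1 ×ˢ Metric.closedBall (0 : ℂ) 1) :=
    (continuousOn_ddbar_snd hu).mono (prod_mono_right (subset_univ (Metric.closedBall (0 : ℂ) 1)))
  obtain ⟨a, -, ha⟩ := hK.exists_isMinOn hne hc
  obtain ⟨b, -, hb⟩ := hK.exists_isMaxOn hne hc
  refine ⟨ddbar (u a.1) a.2, hpos a.1 a.2, ddbar (u b.1) b.2, fun t ht z hz => ?_⟩
  have hmem : (t, z) ∈ Icc (0 : ℝ) 1 ×ˢ Metric.closedBall (0 : ℂ) 1 :=
    mk_mem_prod ht (mem_closedBall_zero_iff.2 hz)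
  have hmin : ddbar (u a.1) a.2 ≤ ddbar (u t) z := isMinOn_iff.1 ha (t, z) hmem
  have hmax : ddbar (u t) z ≤ ddbar (u b.1) b.2 := isMaxOn_iff.1 hb (t, z) hmem
  exact ⟨hmin, hmax⟩

/-- The ratios `G_t'' / GP''` along a smooth path are bounded uniformly in time. -/
theorem exists_Gam_bounds {h : ℝ → ToricMetric}
    (h1 : ContDiffOn ℝ ∞ (fun p : ℝ × ℂ => (h p.1).pot p.2) (Icc 0 1 ×ˢ univ))
    (h2 : ContDiffOn ℝ ∞ (fun p : ℝ × ℂ => (h p.1).potInf p.2) (Icc 0 1 ×ˢ univ)) :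
    ∃ m M : ℝ, 0 < m ∧ m ≤ 1 ∧ 1 ≤ M ∧
      ∀ t ∈ Icc (0 : ℝ) 1, ∀ x, m ≤ (h t).Gam x ∧ (h t).Gam x ≤ M := by
  obtain ⟨m₁, hm₁, M₁, hb₁⟩ := exists_ddbar_bounds (u := fun t => (h t).pot) h1
    fun t => (h t).pos_pot
  obtain ⟨m₂, hm₂, M₂, hb₂⟩ := exists_ddbar_bounds (u := fun t => (h t).potInf) h2
    fun t => (h t).pos_potInf
  set m := min m₁ m₂
  set M := max M₁ M₂
  have hm : 0 < m := lt_min hm₁ hm₂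
  have hM : 0 < M := by
    obtain ⟨a, b⟩ := hb₁ 0 (by simp) 0 (by simp)
    exact (hm₁.trans_le (a.trans b)).trans_le (le_max_left _ _)
  -- Including `1` covers the boundary values of `Gam` and gives the constraints `m ≤ 1 ≤ M` needed
  -- for scaling.
  refine ⟨min (m ^ 2 / M) 1, max (M / m) 1, lt_min (by positivity) one_pos, min_le_right _ _,
    le_max_right _ _, fun t ht x => ?_⟩
  by_cases hx : x ∈ Ioo (0 : ℝ) 1
  · obtain ⟨a, b⟩ := (h t).Gam_bounds hm
      (fun z hz => ⟨(min_le_left _ _).trans (hb₁ t ht z hz).1,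
        (hb₁ t ht z hz).2.trans (le_max_left _ _)⟩)
      (fun z hz => ⟨(min_le_right _ _).trans (hb₂ t ht z hz).1,
        (hb₂ t ht z hz).2.trans (le_max_right _ _)⟩) hx
    exact ⟨(min_le_left _ _).trans a, b.trans (le_max_left _ _)⟩
  · rw [ToricMetric.Gam, if_neg hx]
    exact ⟨min_le_right _ _, le_max_right _ _⟩

end ToricCP1

theorem theorem3p1 (h : ℝ → ToricCP1.ToricMetric) (hgeo : ToricCP1.IsGeodesic h) :
    (∃ C : ℝ, 0 < C ∧ ∀ N : ℕ, 0 < N → ∀ α ∈ Icc (0 : ℝ) 1, ∀ t ∈ Icc (0 : ℝ) 1,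
      1 / C ≤ ToricCP1.q (h t) N α ∧ ToricCP1.q (h t) N α ≤ C) ∧
    ∀ t ∈ Icc (0 : ℝ) 1, ∃ Ω : ℝ → ℝ,
      (∀ α ∈ Ioo (0 : ℝ) 1,
        Ω α = Real.sqrt (deriv (deriv ToricCP1.GP) α / deriv (deriv (h t).G) α)) ∧
      ContinuousOn Ω (Icc 0 1) ∧
      TendstoUniformlyOn (fun (N : ℕ) (α : ℝ) => ToricCP1.q (h t) N α) Ω atTop (Icc 0 1) := by
  obtain ⟨m, M, hm, hm1, hM1, hb⟩ := ToricCP1.exists_Gam_bounds hgeo.smooth hgeo.smoothInf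
  refine ⟨⟨max M (1 / m), lt_max_of_lt_right (by positivity), fun N _ α hα t ht => ?_⟩,
    fun t ht => ?_⟩
  · obtain ⟨h1, h2⟩ := ToricCP1.laplaceInt_ratio_bounds hα ((h t).isDivergence_divG hα) hm hm1 hM1
      (fun x _ => (hb t ht x).1) (fun x _ => (hb t ht x).2) (Nat.cast_nonneg N)
    rw [ToricCP1.q_eq]
    exact ⟨(one_div_le_one_div_of_le (by linarith) (le_max_left _ _)).trans h1,
      h2.trans (le_max_right _ _)⟩
  · obtain ⟨hc, hlim⟩ := ToricCP1.tendstoUniformlyOn_laplaceInt_ratio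
      (fun α hα => (h t).isDivergence_divG hα) hm (fun x _ => (hb t ht x).1)
      (h t).continuousOn_Gam (h t).Gam_zero (h t).Gam_one
    -- On `(0, 1)` this is `(GP'' / G_t'') ^ (1/2)`; the boundary values of `Gam` supply the
    -- continuous extension.
    refine ⟨fun α => √(1 / (h t).Gam α), fun α hα => ?_, hc, ?_⟩
    · rw [(h t).deriv_deriv_GP_div hα]
    · simpa only [ToricCP1.q_eq] using hlim
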